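/- Let $r\ge 1$ be an integer and $\alpha_1,\alpha_2,\sigma_0^2>0$. For every $n\ge1$ let $X_n$ be a (deterministic) real $n\times p_n$ matrix. Let $\boldsymbol t$ be a fixed finite set of indices with $\boldsymbol t\subseteq\{1,\dots,p_n\}$ for all $n$, and let $\beta_0\in\mathbb R^{p_n}$ be the vector whose coordinates in $\boldsymbol t$ are fixed nonzero numbers not depending on $n$ and whose other coordinates are $0$. The data are $\boldsymbol y_n=X_n\beta_0+\boldsymbol\epsilon_n$, where the $n$ coordinates of $\boldsymbol\epsilon_n$ are i.i.d. $N(0,\sigma_0^2)$. A model is a subset $\boldsymbol k\subseteq\{1,\dots,p_n\}$; $X_k$ is the submatrix of the columns of $X_n$ with index in $\boldsymbol k$. Let $\pi=\pi_n$ be a prior probability distribution on the models, and consider the hierarchical model $$\boldsymbol Y_n\mid\beta_k,\tau,\sigma^2,\boldsymbol k\sim N(X_k\beta_k,\sigma^2I_n),$$ $$\pi(\beta_k\mid\tau,\sigma^2,\boldsymbol k)=\frac{(\tau\sigma^2)^{r|\boldsymbol k|/2}}{\Gamma(r/2)^{|\boldsymbol k|}}\prod_{i\in\boldsymbol k}|\beta_i|^{-(r+1)}\exp\Big(-\frac{\tau\sigma^2}{\beta_i^2}\Big),$$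 $$\pi(\tau)=\frac{(n/2)^{1/2}}{\Gamma(1/2)}\tau^{-3/2}e^{-n/(2\tau)},\qquad \pi(\sigma^2)=\frac{\alpha_2^{\alpha_1}}{\Gamma(\alpha_1)}(\sigma^2)^{-(\alpha_1+1)}e^{-\alpha_2/\sigma^2}\qquad(\tau,\sigma^2>0).$$ Let $m_{\boldsymbol k}(\boldsymbol y_n)$ be the marginal density of the data under $\boldsymbol k$ (the integral over $\beta_k\in\mathbb R^{\boldsymbol k}$, $\sigma^2>0$ and $\tau>0$ of the product of these four densities), and let $\pi(\boldsymbol k\mid\boldsymbol y_n)=\pi(\boldsymbol k)m_{\boldsymbol k}(\boldsymbol y_n)/\sum_{\boldsymbol l}\pi(\boldsymbol l)m_{\boldsymbol l}(\boldsymbol y_n)$ be the posterior probability of $\boldsymbol k$. Assume: 1. There are $\epsilon_n\in(0,1)$ with $\epsilon_n^{-1}=O((\log n)^{1/8})$ such that for every $n\ge 1$ and every model $\boldsymbol k$ the $\min(n,|\boldsymbol k|)$ largest eigenvalues (with multiplicity) of $X_k^TX_k/n$ all lie in $[\epsilon_n,\epsilon_n^{-1}]$. 2. $p_n=O(n^\gamma)$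 with $\gamma<r$. 3. $\pi(\boldsymbol k)=0$ whenever $|\boldsymbol k|>q_n$, where $q_n=O(n^\xi)$ with $\xi<1$ and $\xi<1-\frac{4\gamma}{3r}$. 4. There is a constant $\omega>0$, not depending on $n$, such that $\pi(\boldsymbol t)/\pi(\boldsymbol k)>\omega$ for every $n$ and every $\boldsymbol k$ with $\pi(\boldsymbol k)>0$. Then $\pi(\boldsymbol t\mid\boldsymbol y_n)\to1$ in probability as $n\to\infty$. -/

import Mathlib

open MeasureTheory ProbabilityTheory Filter Topology Asymptotics
open scoped NNReal ENNReal Matrix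

namespace HyperPiMOM

/-- The submatrix `X_k` of the columns of the design matrix `X` that belong to the model `k`. -/
def modelMatrix {n p : ℕ} (X : Matrix (Fin n) (Fin p) ℝ) (k : Finset (Fin p)) :
    Matrix (Fin n) k ℝ :=
  X.submatrix id (fun j : k => (j : Fin p))

/-- The scaled Gram matrix `X_kᵀ X_k / n`. -/
noncomputable def gram {n p : ℕ} (X : Matrix (Fin n) (Fin p) ℝ) (k : Finset (Fin p)) :
    Matrix k k ℝ :=
  (1 / (n : ℝ)) • ((modelMatrix X k)ᵀ * modelMatrix X k)

theorem gram_isHermitian {n p : ℕ} (X : Matrix (Fin n) (Fin p) ℝ) (k : Finset (Fin p)) :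
    (gram X k).IsHermitian := by
  unfold Matrix.IsHermitian gram
  simp [Matrix.conjTranspose_eq_transpose_of_trivial, Matrix.transpose_mul]

/-- The eigenvalues of `X_kᵀ X_k / n`, with multiplicity and in decreasing order; the index `j`
starts at `0`, so `nu X k j` is the `(j+1)`-st largest eigenvalue. -/
noncomputable def nu {n p : ℕ} (X : Matrix (Fin n) (Fin p) ℝ) (k : Finset (Fin p))
    (j : Fin (Fintype.card k)) : ℝ :=
  (gram_isHermitian X k).eigenvalues₀ j

/-- For every model `k`, the `min(n, |k|)` largest eigenvalues of `X_kᵀ X_k / n` (the only ones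
that can be nonzero) all lie in `[ε, ε⁻¹]`. -/
def EigenvalueBounds {n p : ℕ} (X : Matrix (Fin n) (Fin p) ℝ) (ε : ℝ) : Prop :=
  ∀ (k : Finset (Fin p)) (j : Fin (Fintype.card k)), (j : ℕ) < n →
    ε ≤ nu X k j ∧ nu X k j ≤ ε⁻¹

/-- The true model `t`: the positions of the nonzero coordinates of `β₀`. -/
def trueModel (p : ℕ) (β₀ : ℕ →₀ ℝ) : Finset (Fin p) :=
  {i : Fin p | (i : ℕ) ∈ β₀.support}

/-- The density at `y` of the normal distribution `N(X_k β, s I_n)`, where `s` is the variance. -/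
noncomputable def likelihood {n p : ℕ} (X : Matrix (Fin n) (Fin p) ℝ) (k : Finset (Fin p))
    (s : ℝ) (β : k → ℝ) (y : Fin n → ℝ) : ℝ :=
  (2 * Real.pi * s) ^ (-((n : ℝ) / 2)) *
    Real.exp (-(∑ i, (y i - (modelMatrix X k *ᵥ β) i) ^ 2) / (2 * s))

/-- The product piMOM density of order `r` with scale `τ` and variance `s`. -/
noncomputable def piMOM {ι : Type*} [Fintype ι] (r : ℕ) (τ s : ℝ) (β : ι → ℝ) : ℝ :=
  ∏ i, (τ * s) ^ ((r : ℝ) / 2) / Real.Gamma ((r : ℝ) / 2) *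
    (|β i| ^ (r + 1))⁻¹ * Real.exp (-(τ * s) / (β i) ^ 2)

/-- The density at `x > 0` of the inverse gamma distribution with shape `a` and scale `b`. -/
noncomputable def invGamma (a b x : ℝ) : ℝ :=
  b ^ a / Real.Gamma a * x ^ (-(a + 1)) * Real.exp (-b / x)

/-- The marginal density `m_k(y)` of the data under the model `k`: the likelihood is integrated
against the piMOM prior on the coefficients, the inverse gamma prior with shape `1/2` and scale
`n/2` on `τ`, and the inverse gamma prior with shape `α₁` and scale `α₂` on the variance `s`. -/
noncomputable def marginal {n p : ℕ} (r : ℕ) (α₁ α₂ : ℝ) (X : Matrix (Fin n) (Fin p) ℝ)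
    (k : Finset (Fin p)) (y : Fin n → ℝ) : ℝ≥0∞ :=
  ∫⁻ τ in Set.Ioi (0 : ℝ), ∫⁻ s in Set.Ioi (0 : ℝ), ∫⁻ β : k → ℝ,
    ENNReal.ofReal (likelihood X k s β y * piMOM r τ s β *
      invGamma (1 / 2) ((n : ℝ) / 2) τ * invGamma α₁ α₂ s)

/-- The posterior probability of the model `k` given the data `y`, by Bayes' rule. -/
noncomputable def posterior {n p : ℕ} (r : ℕ) (α₁ α₂ : ℝ) (prior : PMF (Finset (Fin p)))
    (X : Matrix (Fin n) (Fin p) ℝ) (k : Finset (Fin p)) (y : Fin n → ℝ) : ℝ :=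
  (prior k * marginal r α₁ α₂ X k y / ∑ l, prior l * marginal r α₁ α₂ X l y).toReal

end HyperPiMOM

/-! Every marginal density is compared with `peak n T`, the largest Gaussian likelihood compatible
with a residual sum of squares `T`, here the squared length of the errors. Let `z = n ^ η` with a
small `η > 0`. Outside of an event of vanishing probability, `T` is of order `n` and the errors are
nearly orthogonal to all columns of the design. On that event the true model satisfies
`m_t ≥ peak n T * exp (-√n z²)`, already from the part of the integral near the true coefficients. A
model that misses a true coefficient has a residual sum of squares larger than `T` by `n / z²`. A
model with superfluous columns fits hardly better than the truth. Its prior gives `τ ≤ z⁸` mass at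
most `exp (-n / (4z⁸))`, up to a constant, and for `τ ≥ z⁸` the piMOM factor `exp (-τ s / b²)` of a
superfluous coefficient `b` and its least-squares cost `exp (-n b² / (4 z s))` multiply, by AM-GM,
to at most `exp (-√(n τ / z))`. In both cases `m_k ≤ exp (-(|k| + 1) z) * m_t`, and the sum of these
ratios over all models vanishes because `p` grows only polynomially. -/

namespace HyperPiMOM

/-! ### Residual sums of squares -/

open scoped MatrixOrder in
theorem mul_dotProduct_self_le_dotProduct_mulVec {ι : Type*} [Fintype ι] [DecidableEq ι]
    {A : Matrix ι ι ℝ} (hA : A.IsHermitian) {a : ℝ} (ha : ∀ i, a ≤ hA.eigenvalues i)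
    (v : ι → ℝ) : a * (v ⬝ᵥ v) ≤ v ⬝ᵥ (A *ᵥ v) := by
  have hle : algebraMap ℝ (Matrix ι ι ℝ) a ≤ A := by
    rw [algebraMap_le_iff_le_spectrum (ha := hA), hA.spectrum_real_eq_range_eigenvalues]
    exact Set.forall_mem_range.2 ha
  simpa [Matrix.sub_mulVec, Algebra.algebraMap_eq_smul_one, Matrix.smul_mulVec]
    using (Matrix.le_iff.1 hle).dotProduct_mulVec_nonneg v

open scoped MatrixOrder in
theorem dotProduct_mulVec_le_mul_dotProduct_self {ι : Type*} [Fintype ι] [DecidableEq ι]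
    {A : Matrix ι ι ℝ} (hA : A.IsHermitian) {b : ℝ} (hb : ∀ i, hA.eigenvalues i ≤ b)
    (v : ι → ℝ) : v ⬝ᵥ (A *ᵥ v) ≤ b * (v ⬝ᵥ v) := by
  have hle : A ≤ algebraMap ℝ (Matrix ι ι ℝ) b := by
    rw [le_algebraMap_iff_spectrum_le (ha := hA), hA.spectrum_real_eq_range_eigenvalues]
    exact Set.forall_mem_range.2 hb
  simpa [Matrix.sub_mulVec, Algebra.algebraMap_eq_smul_one, Matrix.smul_mulVec]
    using (Matrix.le_iff.1 hle).dotProduct_mulVec_nonneg v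

theorem modelMatrix_mulVec {n p : ℕ} (X : Matrix (Fin n) (Fin p) ℝ) (k : Finset (Fin p))
    (β : k → ℝ) : modelMatrix X k *ᵥ β = X *ᵥ Function.extend Subtype.val β 0 := by
  ext i
  simp only [Matrix.mulVec, dotProduct, modelMatrix, Matrix.submatrix_apply, id]
  rw [← Finset.sum_subset (Finset.subset_univ k), ← Finset.sum_attach k, Finset.univ_eq_attach]
  · simp only [Subtype.val_injective.extend_apply]
  · intro j _ hj
    rw [Function.extend_apply' _ _ _ (by rintro ⟨⟨_, h⟩, rfl⟩; exact hj h), Pi.zero_apply,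
      mul_zero]

theorem EigenvalueBounds.mono {n p : ℕ} {X : Matrix (Fin n) (Fin p) ℝ} {δ ε : ℝ}
    (hX : EigenvalueBounds X ε) (hδ : 0 < δ) (h : δ ≤ ε) : EigenvalueBounds X δ := fun k j hj =>
  ⟨h.trans (hX k j hj).1, (hX k j hj).2.trans (inv_anti₀ hδ h)⟩

section EigenvalueBounds

variable {n p : ℕ} {X : Matrix (Fin n) (Fin p) ℝ} {ε : ℝ} {K : Finset (Fin p)} {θ : Fin p → ℝ}

theorem sum_sq_eq_dotProduct_restrict (hθ : ∀ i ∉ K, θ i = 0) :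
    ∑ i, θ i ^ 2 = K.restrict θ ⬝ᵥ K.restrict θ := by
  rw [← Finset.sum_subset (Finset.subset_univ K) fun i _ hi => by simp [hθ i hi],
    ← Finset.sum_attach K]
  simp [dotProduct, sq]

theorem sum_sq_mulVec_eq_gram (hn : 0 < n) (hθ : ∀ i ∉ K, θ i = 0) :
    ∑ i, (X *ᵥ θ) i ^ 2 = n * (K.restrict θ ⬝ᵥ (gram X K *ᵥ K.restrict θ)) := by
  have hext : Function.extend Subtype.val (K.restrict θ) 0 = θ := by
    ext i
    by_cases hi : i ∈ K
    · exact Subtype.val_injective.extend_apply _ _ ⟨i, hi⟩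
    · rw [Function.extend_apply' _ _ _ (by rintro ⟨⟨_, h⟩, rfl⟩; exact hi h), hθ i hi,
        Pi.zero_apply]
  rw [gram, Matrix.smul_mulVec, dotProduct_smul, smul_eq_mul, ← mul_assoc,
    mul_one_div_cancel (by positivity), one_mul, ← Matrix.mulVec_mulVec, Matrix.dotProduct_mulVec,
    Matrix.vecMul_transpose, modelMatrix_mulVec, hext]
  simp [dotProduct, sq]

theorem EigenvalueBounds.le_sum_sq_mulVec (hX : EigenvalueBounds X ε) (hn : 0 < n)
    (hK : K.card ≤ n) (hθ : ∀ i ∉ K, θ i = 0) :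
    n * ε * ∑ i, θ i ^ 2 ≤ ∑ i, (X *ᵥ θ) i ^ 2 := by
  rw [sum_sq_mulVec_eq_gram hn hθ, sum_sq_eq_dotProduct_restrict hθ, mul_assoc]
  refine mul_le_mul_of_nonneg_left (mul_dotProduct_self_le_dotProduct_mulVec
    (gram_isHermitian X K) (fun i => (hX K _ ?_).1) _) n.cast_nonneg
  exact (Fin.is_lt _).trans_le (by simpa using hK)

theorem EigenvalueBounds.sum_sq_mulVec_le (hX : EigenvalueBounds X ε) (hn : 0 < n)
    (hK : K.card ≤ n) (hθ : ∀ i ∉ K, θ i = 0) :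
    ∑ i, (X *ᵥ θ) i ^ 2 ≤ n * ε⁻¹ * ∑ i, θ i ^ 2 := by
  rw [sum_sq_mulVec_eq_gram hn hθ, sum_sq_eq_dotProduct_restrict hθ, mul_assoc]
  refine mul_le_mul_of_nonneg_left (dotProduct_mulVec_le_mul_dotProduct_self
    (gram_isHermitian X K) (fun i => (hX K _ ?_).2) _) n.cast_nonneg
  exact (Fin.is_lt _).trans_le (by simpa using hK)

theorem EigenvalueBounds.sum_sq_column_le (hX : EigenvalueBounds X ε) (hn : 0 < n) (j : Fin p) :
    ∑ i, X i j ^ 2 ≤ n * ε⁻¹ := by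
  have hcard : ({j} : Finset (Fin p)).card ≤ n := by simpa using Nat.succ_le_of_lt hn
  have h := hX.sum_sq_mulVec_le hn hcard (θ := Pi.single j 1) fun i hi =>
    Pi.single_eq_of_ne (by simpa using hi) _
  simpa [Pi.single_apply, ite_pow] using h

end EigenvalueBounds

section Perturbation

variable {ι κ : Type*} [Fintype ι] [Fintype κ] {X : Matrix ι κ ℝ} {e : ι → ℝ} {M : ℝ}

theorem abs_dotProduct_mulVec_le (hM : ∀ j, |∑ i, X i j * e i| ≤ M) (θ : κ → ℝ) :
    |e ⬝ᵥ (X *ᵥ θ)| ≤ M * ∑ j, |θ j| := by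
  have hcol : ∀ j, (e ᵥ* X) j = ∑ i, X i j * e i := fun j => by
    simp only [Matrix.vecMul, dotProduct, mul_comm]
  rw [Matrix.dotProduct_mulVec, dotProduct, Finset.mul_sum]
  refine (Finset.abs_sum_le_sum_abs _ _).trans (Finset.sum_le_sum fun j _ => ?_)
  rw [abs_mul, hcol]
  exact mul_le_mul_of_nonneg_right (hM j) (abs_nonneg _)

theorem sum_sub_sq (e v : ι → ℝ) :
    ∑ i, (e i - v i) ^ 2 = ∑ i, e i ^ 2 - 2 * (e ⬝ᵥ v) + ∑ i, v i ^ 2 := by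
  rw [dotProduct, Finset.mul_sum, ← Finset.sum_sub_distrib, ← Finset.sum_add_distrib]
  exact Finset.sum_congr rfl fun _ _ => by ring

theorem two_mul_sum_abs_le {K : Finset κ} {θ : κ → ℝ} (hθ : ∀ j ∉ K, θ j = 0) {c : ℝ}
    (hc : 0 < c) (M : ℝ) :
    2 * (M * ∑ j, |θ j|) ≤ 2 * K.card * (M ^ 2 / c) + c / 2 * ∑ j, θ j ^ 2 := by
  have hsum : ∀ f : ℝ → ℝ, f 0 = 0 → ∑ j, f (θ j) = ∑ j ∈ K, f (θ j) := fun f hf =>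
    (Finset.sum_subset K.subset_univ fun j _ hj => by rw [hθ j hj, hf]).symm
  have hcard : (2 : ℝ) * K.card * (M ^ 2 / c) = ∑ _j ∈ K, 2 * (M ^ 2 / c) := by
    rw [Finset.sum_const, nsmul_eq_mul]
    ring
  rw [hsum (|·|) abs_zero, hsum (· ^ 2) (by norm_num), hcard, Finset.mul_sum, Finset.mul_sum,
    Finset.mul_sum, ← Finset.sum_add_distrib]
  refine Finset.sum_le_sum fun j _ => ?_
  have hsq : 2 * (M ^ 2 / c) + c / 2 * θ j ^ 2 - 2 * (M * |θ j|) =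
      (2 * M - c * |θ j|) ^ 2 / (2 * c) := by
    rw [← sq_abs (θ j)]
    field_simp
    ring
  have hnonneg : 0 ≤ (2 * M - c * |θ j|) ^ 2 / (2 * c) := by positivity
  linarith

end Perturbation

/-- The residual sum of squares `‖y - X_k β‖²` of the model `k` at the coefficients `β`; the
likelihood depends on the data only through it. -/
noncomputable def rss {n p : ℕ} (X : Matrix (Fin n) (Fin p) ℝ) (k : Finset (Fin p))
    (y : Fin n → ℝ) (β : k → ℝ) : ℝ :=
  ∑ i, (y i - (modelMatrix X k *ᵥ β) i) ^ 2

/-- The data `y = X β₀ + e` produced by the true coefficients `β₀` and the error vector `e`. -/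
noncomputable def observation {n p : ℕ} (X : Matrix (Fin n) (Fin p) ℝ) (β₀ : ℕ →₀ ℝ)
    (e : Fin n → ℝ) : Fin n → ℝ :=
  fun i => (X *ᵥ fun j : Fin p => β₀ j) i + e i

/-- The estimation error `β - β₀` of the coefficients `β` of the model `k`, extended by zero to
all columns. -/
noncomputable def coeffError {p : ℕ} (β₀ : ℕ →₀ ℝ) (k : Finset (Fin p)) (β : k → ℝ) :
    Fin p → ℝ :=
  fun j => Function.extend Subtype.val β 0 j - β₀ j

section coeffError

variable {n p : ℕ} {β₀ : ℕ →₀ ℝ} {k : Finset (Fin p)}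

theorem mem_trueModel {i : Fin p} : i ∈ trueModel p β₀ ↔ β₀ i ≠ 0 := by
  simp [trueModel]

theorem card_trueModel_le (p : ℕ) (β₀ : ℕ →₀ ℝ) : (trueModel p β₀).card ≤ β₀.support.card :=
  Finset.card_le_card_of_injOn (fun i => (i : ℕ)) (fun _ hi => (Finset.mem_filter.1 hi).2)
    Fin.val_injective.injOn

theorem coeffError_of_mem (β : k → ℝ) {j : Fin p} (hj : j ∈ k) :
    coeffError β₀ k β j = β ⟨j, hj⟩ - β₀ j :=
  congrArg (· - β₀ j) (Subtype.val_injective.extend_apply β 0 ⟨j, hj⟩)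

theorem coeffError_of_notMem (β : k → ℝ) {j : Fin p} (hj : j ∉ k) :
    coeffError β₀ k β j = -β₀ j := by
  rw [coeffError, Function.extend_apply' _ _ _ (by rintro ⟨⟨_, h⟩, rfl⟩; exact hj h),
    Pi.zero_apply, zero_sub]

theorem coeffError_eq_zero (β : k → ℝ) {j : Fin p} (hj : j ∉ k ∪ trueModel p β₀) :
    coeffError β₀ k β j = 0 := by
  rw [Finset.mem_union, not_or, mem_trueModel, not_not] at hj
  rw [coeffError_of_notMem β hj.1, hj.2, neg_zero]

theorem rss_observation (X : Matrix (Fin n) (Fin p) ℝ) (e : Fin n → ℝ) (β : k → ℝ) :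
    rss X k (observation X β₀ e) β = ∑ i, (e i - (X *ᵥ coeffError β₀ k β) i) ^ 2 := by
  have hsub : X *ᵥ coeffError β₀ k β = modelMatrix X k *ᵥ β - X *ᵥ fun j : Fin p => β₀ j := by
    rw [modelMatrix_mulVec, ← Matrix.mulVec_sub]
    rfl
  refine Finset.sum_congr rfl fun i _ => ?_
  rw [hsub, Pi.sub_apply, observation]
  ring

variable {X : Matrix (Fin n) (Fin p) ℝ} {e : Fin n → ℝ} {z : ℝ}

theorem le_rss_observation (hn : 0 < n) (hz : 0 < z) (hX : EigenvalueBounds X z⁻¹)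
    (hk : (k ∪ trueModel p β₀).card ≤ n) (he : ∀ j, |∑ i, X i j * e i| ≤ √n * z) (β : k → ℝ) :
    ∑ i, e i ^ 2 - 2 * (k ∪ trueModel p β₀).card * z ^ 3 +
        n / (2 * z) * ∑ j, coeffError β₀ k β j ^ 2 ≤ rss X k (observation X β₀ e) β := by
  have hθ : ∀ j ∉ k ∪ trueModel p β₀, coeffError β₀ k β j = 0 := fun _ => coeffError_eq_zero β
  have hquad := hX.le_sum_sq_mulVec hn hk hθ
  have hlin := (abs_le.1 (abs_dotProduct_mulVec_le he (coeffError β₀ k β))).2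
  have hamgm := two_mul_sum_abs_le hθ (show 0 < n * z⁻¹ by positivity) (√n * z)
  have hM : (√n * z) ^ 2 / (n * z⁻¹) = z ^ 3 := by
    rw [mul_pow, Real.sq_sqrt n.cast_nonneg]
    field_simp
  have hc : (n : ℝ) / (2 * z) = n * z⁻¹ / 2 := by field_simp
  rw [hM] at hamgm
  rw [rss_observation, sum_sub_sq, hc]
  linarith

theorem rss_observation_le (hn : 0 < n) (hz : 0 ≤ z) (hX : EigenvalueBounds X z⁻¹)
    (hk : k.card ≤ n) (htk : trueModel p β₀ ⊆ k) (he : ∀ j, |∑ i, X i j * e i| ≤ √n * z)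
    {β : k → ℝ} (hβ : ∀ j, |β j - β₀ (j : Fin p)| ≤ 1 / √n) :
    rss X k (observation X β₀ e) β ≤ ∑ i, e i ^ 2 + 3 * k.card * z := by
  set θ := coeffError β₀ k β with hθdef
  have hsqrt : 0 < √(n : ℝ) := by positivity
  have hsqn : √(n : ℝ) ^ 2 = n := Real.sq_sqrt n.cast_nonneg
  have hθ : ∀ j ∉ k, θ j = 0 := fun j hj =>
    coeffError_eq_zero β (by rwa [Finset.union_eq_left.2 htk])
  have habs : ∀ j ∈ k, |θ j| ≤ 1 / √n := fun j hj => by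
    simpa only [hθdef, coeffError_of_mem β hj] using hβ ⟨j, hj⟩
  have hsum : ∑ j, |θ j| ≤ k.card * (1 / √n) := by
    rw [← Finset.sum_subset k.subset_univ fun j _ hj => by simp [hθ j hj]]
    simpa using Finset.sum_le_card_nsmul k (|θ ·|) _ habs
  have hsum_sq : ∑ j, θ j ^ 2 ≤ k.card * (1 / n) := by
    rw [← Finset.sum_subset k.subset_univ fun j _ hj => by simp [hθ j hj]]
    have hsq : ∀ j ∈ k, θ j ^ 2 ≤ 1 / n := fun j hj => by
      rw [← sq_abs, ← hsqn, ← one_div_pow]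
      exact pow_le_pow_left₀ (abs_nonneg _) (habs j hj) 2
    simpa using Finset.sum_le_card_nsmul k (θ · ^ 2) _ hsq
  have hlin : -(e ⬝ᵥ (X *ᵥ θ)) ≤ k.card * z :=
    calc -(e ⬝ᵥ (X *ᵥ θ)) ≤ √n * z * ∑ j, |θ j| :=
          (neg_le_abs _).trans (abs_dotProduct_mulVec_le he θ)
      _ ≤ √n * z * (k.card * (1 / √n)) := by gcongr
      _ = k.card * z := by field_simp
  have hquad : ∑ i, (X *ᵥ θ) i ^ 2 ≤ k.card * z :=
    calc ∑ i, (X *ᵥ θ) i ^ 2 ≤ n * z * ∑ j, θ j ^ 2 := by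
          simpa only [inv_inv] using hX.sum_sq_mulVec_le hn hk hθ
      _ ≤ n * z * (k.card * (1 / n)) := by gcongr
      _ = k.card * z := by field_simp
  rw [rss_observation, sum_sub_sq]
  linarith

end coeffError

/-! ### The prior densities -/

theorem integral_rpow_mul_exp_neg_rpow {m a b : ℝ} (hm : 0 < m) (ha : 0 < a) (hb : 0 < b) :
    ∫ x in Set.Ioi (0 : ℝ), x ^ (-(m * a + 1)) * Real.exp (-b * x ^ (-m)) =
      Real.Gamma a * b ^ (-a) / m := by
  have hsubst := integral_comp_rpow_Ioi (fun u : ℝ => u ^ (a - 1) * Real.exp (-(b * u)))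
    (neg_ne_zero.2 hm.ne')
  have hintegrand : ∀ x ∈ Set.Ioi (0 : ℝ),
      (|-m| * x ^ (-m - 1)) • ((x ^ (-m)) ^ (a - 1) * Real.exp (-(b * x ^ (-m)))) =
        m * (x ^ (-(m * a + 1)) * Real.exp (-b * x ^ (-m))) := fun x hx => by
    have hpow : x ^ (-(m * a + 1)) = x ^ (-m - 1) * (x ^ (-m)) ^ (a - 1) := by
      rw [← Real.rpow_mul (le_of_lt hx), ← Real.rpow_add hx]
      ring_nf
    simp only [abs_neg, abs_of_pos hm, smul_eq_mul, hpow, neg_mul]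
    ring
  rw [setIntegral_congr_fun measurableSet_Ioi hintegrand, integral_const_mul,
    Real.integral_rpow_mul_exp_neg_mul_Ioi ha hb] at hsubst
  rw [eq_div_iff hm.ne', mul_comm, hsubst, one_div, Real.inv_rpow hb.le, Real.rpow_neg hb.le]
  ring

theorem lintegral_ofReal_eq_one {α : Type*} [MeasurableSpace α] {μ : Measure α} {f : α → ℝ}
    (hf : 0 ≤ᵐ[μ] f) (h : ∫ x, f x ∂μ = 1) : ∫⁻ x, ENNReal.ofReal (f x) ∂μ = 1 := by
  rw [← ofReal_integral_eq_lintegral_ofReal (.of_integral_ne_zero (h ▸ one_ne_zero)) hf, h,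
    ENNReal.ofReal_one]

section invGamma

variable {a b x : ℝ}

theorem invGamma_pos (ha : 0 < a) (hb : 0 < b) (hx : 0 < x) : 0 < invGamma a b x := by
  unfold invGamma
  positivity

theorem integral_invGamma (ha : 0 < a) (hb : 0 < b) :
    ∫ x in Set.Ioi (0 : ℝ), invGamma a b x = 1 := by
  have hintegrand : ∀ x : ℝ, invGamma a b x =
      b ^ a / Real.Gamma a * (x ^ (-(1 * a + 1)) * Real.exp (-b * x ^ (-(1 : ℝ)))) := fun x => by
    rw [invGamma, one_mul, Real.rpow_neg_one, div_eq_mul_inv (-b), mul_assoc]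
  simp only [hintegrand]
  rw [integral_const_mul, integral_rpow_mul_exp_neg_rpow one_pos ha hb, Real.rpow_neg hb.le]
  field_simp

theorem lintegral_invGamma (ha : 0 < a) (hb : 0 < b) :
    ∫⁻ x in Set.Ioi (0 : ℝ), ENNReal.ofReal (invGamma a b x) = 1 :=
  lintegral_ofReal_eq_one ((ae_restrict_mem measurableSet_Ioi).mono fun _ hx =>
    (invGamma_pos ha hb hx).le) (integral_invGamma ha hb)

theorem le_invGamma {l u : ℝ} (ha : 0 < a) (hb : 0 < b) (hl : 0 < l) (hx : x ∈ Set.Icc l u) :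
    b ^ a / Real.Gamma a * u ^ (-(a + 1)) * Real.exp (-(b / l)) ≤ invGamma a b x := by
  have hx0 : 0 < x := hl.trans_le hx.1
  have hpow : u ^ (-(a + 1)) ≤ x ^ (-(a + 1)) :=
    Real.rpow_le_rpow_of_nonpos hx0 hx.2 (by linarith)
  have hexp : -(b / l) ≤ -b / x := by
    rw [neg_div, neg_le_neg_iff]
    gcongr
    exact hx.1
  unfold invGamma
  gcongr

end invGamma

/-- The piMOM density of order `r` on the line. The scale `c` stands for the product `τ * s` in
`piMOM`, which is a product of such densities. -/
noncomputable def piMOMDensity (r : ℕ) (c b : ℝ) : ℝ :=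
  c ^ ((r : ℝ) / 2) / Real.Gamma ((r : ℝ) / 2) * (|b| ^ (r + 1))⁻¹ * Real.exp (-c / b ^ 2)

theorem piMOM_eq_prod {ι : Type*} [Fintype ι] (r : ℕ) (τ s : ℝ) (β : ι → ℝ) :
    piMOM r τ s β = ∏ i, piMOMDensity r (τ * s) (β i) :=
  rfl

section piMOM

variable {r : ℕ} {c : ℝ}

theorem piMOMDensity_nonneg (hr : 0 < r) (hc : 0 ≤ c) (b : ℝ) : 0 ≤ piMOMDensity r c b := by
  unfold piMOMDensity
  positivity

theorem piMOM_nonneg {ι : Type*} [Fintype ι] (hr : 0 < r) {τ s : ℝ} (hτ : 0 ≤ τ) (hs : 0 ≤ s)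
    (β : ι → ℝ) : 0 ≤ piMOM r τ s β :=
  Finset.prod_nonneg fun _ _ => piMOMDensity_nonneg hr (mul_nonneg hτ hs) _

theorem integral_piMOMDensity (hr : 0 < r) (hc : 0 < c) : ∫ b, piMOMDensity r c b = 1 := by
  have hr2 : 0 < (r : ℝ) / 2 := by positivity
  have habs : ∀ b, piMOMDensity r c b = piMOMDensity r c |b| := fun b => by
    simp only [piMOMDensity, abs_abs, sq_abs]
  have hintegrand : ∀ x ∈ Set.Ioi (0 : ℝ), piMOMDensity r c x =
      c ^ ((r : ℝ) / 2) / Real.Gamma ((r : ℝ) / 2) *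
        (x ^ (-(2 * ((r : ℝ) / 2) + 1)) * Real.exp (-c * x ^ (-(2 : ℝ)))) := fun x hx => by
    have hx0 : 0 ≤ x := le_of_lt hx
    have hexponent : 2 * ((r : ℝ) / 2) + 1 = (r + 1 : ℕ) := by
      push_cast
      ring
    rw [piMOMDensity, hexponent, Real.rpow_neg hx0, Real.rpow_natCast, Real.rpow_neg hx0,
      Real.rpow_two, abs_of_nonneg hx0, div_eq_mul_inv (-c), mul_assoc]
  rw [integral_congr_ae (ae_of_all _ habs), integral_comp_abs (f := piMOMDensity r c),
    setIntegral_congr_fun measurableSet_Ioi hintegrand, integral_const_mul,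
    integral_rpow_mul_exp_neg_rpow two_pos hr2 hc, Real.rpow_neg hc.le]
  field_simp

theorem lintegral_piMOM {ι : Type*} [Fintype ι] (hr : 0 < r) {τ s : ℝ} (hτ : 0 < τ) (hs : 0 < s) :
    ∫⁻ β : ι → ℝ, ENNReal.ofReal (piMOM r τ s β) = 1 := by
  refine lintegral_ofReal_eq_one (ae_of_all _ (piMOM_nonneg hr hτ.le hs.le)) ?_
  simp only [piMOM_eq_prod]
  rw [integral_fintype_prod_volume_eq_prod (fun (_ : ι) b => piMOMDensity r (τ * s) b)]
  simp only [integral_piMOMDensity hr (mul_pos hτ hs), Finset.prod_const_one]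

theorem piMOMDensity_eq_two_rpow_mul (hc : 0 ≤ c) (b : ℝ) : piMOMDensity r c b =
    2 ^ ((r : ℝ) / 2) * Real.exp (-(c / 2) / b ^ 2) * piMOMDensity r (c / 2) b := by
  have hpow : c ^ ((r : ℝ) / 2) = 2 ^ ((r : ℝ) / 2) * (c / 2) ^ ((r : ℝ) / 2) := by
    rw [← Real.mul_rpow two_pos.le (by positivity), mul_div_cancel₀ _ two_ne_zero]
  have hexp : Real.exp (-c / b ^ 2) =
      Real.exp (-(c / 2) / b ^ 2) * Real.exp (-(c / 2) / b ^ 2) := by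
    rw [← Real.exp_add]
    ring_nf
  rw [piMOMDensity, piMOMDensity, hpow, hexp]
  ring

theorem piMOMDensity_le (hr : 0 < r) (hc : 0 ≤ c) (b : ℝ) :
    piMOMDensity r c b ≤ 2 ^ ((r : ℝ) / 2) * piMOMDensity r (c / 2) b := by
  have hnonneg := piMOMDensity_nonneg hr (show 0 ≤ c / 2 by positivity) b
  have hexp : Real.exp (-(c / 2) / b ^ 2) ≤ 1 :=
    Real.exp_le_one_iff.2 (div_nonpos_of_nonpos_of_nonneg (by linarith) (sq_nonneg b))
  rw [piMOMDensity_eq_two_rpow_mul hc]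
  gcongr
  exact mul_le_of_le_one_right (by positivity) hexp

theorem sqrt_mul_le_div_add_div {h τ s b : ℝ} (hh : 0 ≤ h) (hτ : 0 < τ) (hs : 0 < s)
    (hb : b ≠ 0) : √(h * τ) ≤ h * b ^ 2 / (2 * s) + τ * s / 2 / b ^ 2 := by
  refine Real.sqrt_le_iff.2 ⟨by positivity, ?_⟩
  have hprod : h * τ = 4 * (h * b ^ 2 / (2 * s)) * (τ * s / 2 / b ^ 2) := by
    field_simp
    ring
  rw [hprod]
  exact four_mul_le_sq_add _ _

/-- A coefficient without counterpart in the truth costs the likelihood at least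
`exp (-h b² / (2s))`, while the prior vanishes near `0` like `exp (-τs / b²)`: by the
arithmetic-geometric inequality it is penalized whatever its value. -/
theorem exp_mul_piMOMDensity_le (hr : 0 < r) {h τ s : ℝ} (hh : 0 ≤ h) (hτ : 0 < τ) (hs : 0 < s)
    (b : ℝ) : Real.exp (-(h * b ^ 2) / (2 * s)) * piMOMDensity r (τ * s) b ≤
      2 ^ ((r : ℝ) / 2) * Real.exp (-√(h * τ)) * piMOMDensity r (τ * s / 2) b := by
  have hnonneg := piMOMDensity_nonneg hr (show 0 ≤ τ * s / 2 by positivity) b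
  rcases eq_or_ne b 0 with rfl | hb
  · simp [piMOMDensity]
  have hexp : Real.exp (-(h * b ^ 2) / (2 * s)) * Real.exp (-(τ * s / 2) / b ^ 2) ≤
      Real.exp (-√(h * τ)) := by
    rw [← Real.exp_add, Real.exp_le_exp, neg_div, neg_div, ← neg_add, neg_le_neg_iff]
    exact sqrt_mul_le_div_add_div hh hτ hs hb
  rw [piMOMDensity_eq_two_rpow_mul (mul_pos hτ hs).le]
  calc _ = 2 ^ ((r : ℝ) / 2) * (Real.exp (-(h * b ^ 2) / (2 * s)) *
        Real.exp (-(τ * s / 2) / b ^ 2)) * piMOMDensity r (τ * s / 2) b := by ring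
    _ ≤ _ := by gcongr

theorem exp_mul_piMOM_le {ι : Type*} [Fintype ι] (hr : 0 < r) {h τ s : ℝ} (hh : 0 ≤ h)
    (hτ : 0 < τ) (hs : 0 < s) (J : Finset ι) (β : ι → ℝ) :
    Real.exp (-(h * ∑ i ∈ J, β i ^ 2) / (2 * s)) * piMOM r τ s β ≤
      2 ^ ((r : ℝ) * Fintype.card ι / 2) * Real.exp (-(J.card * √(h * τ))) *
        piMOM r (τ / 2) s β := by
  classical
  have hlik : Real.exp (-(h * ∑ i ∈ J, β i ^ 2) / (2 * s)) =
      ∏ i, if i ∈ J then Real.exp (-(h * β i ^ 2) / (2 * s)) else 1 := by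
    rw [Finset.prod_ite_mem, Finset.univ_inter, ← Real.exp_sum, Finset.mul_sum,
      ← Finset.sum_neg_distrib, Finset.sum_div]
  have hpenalty : Real.exp (-(J.card * √(h * τ))) =
      ∏ i, if i ∈ J then Real.exp (-√(h * τ)) else 1 := by
    rw [Finset.prod_ite_mem, Finset.univ_inter, Finset.prod_const, ← Real.exp_nat_mul, mul_neg]
  have htwo : (2 : ℝ) ^ ((r : ℝ) * Fintype.card ι / 2) = ∏ _i : ι, (2 : ℝ) ^ ((r : ℝ) / 2) := by
    rw [Finset.prod_const, ← Real.rpow_natCast, ← Real.rpow_mul two_pos.le, Finset.card_univ]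
    ring_nf
  have hτs : 0 ≤ τ * s := (mul_pos hτ hs).le
  rw [hlik, hpenalty, htwo, piMOM_eq_prod, piMOM_eq_prod, ← Finset.prod_mul_distrib,
    ← Finset.prod_mul_distrib, ← Finset.prod_mul_distrib, div_mul_eq_mul_div]
  refine Finset.prod_le_prod (fun i _ => ?_) fun i _ => ?_
  · have := piMOMDensity_nonneg hr hτs (β i)
    split_ifs <;> positivity
  · split_ifs
    · exact exp_mul_piMOMDensity_le hr hh hτ hs _
    · simpa only [one_mul, mul_one] using piMOMDensity_le hr hτs (β i)

end piMOM

theorem exp_mul_invGamma_le {a A b τ : ℝ} (ha : 0 < a) (hA : 0 ≤ A) (hb : 0 < b) (hτ : 0 < τ)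
    (τ₀ : ℝ) : Real.exp (-(A * √τ)) * invGamma a b τ ≤
      2 ^ a * Real.exp (-min (A * √τ₀) (b / (2 * τ₀))) * invGamma a (b / 2) τ := by
  have hpow : b ^ a = 2 ^ a * (b / 2) ^ a := by
    rw [← Real.mul_rpow two_pos.le (by positivity), mul_div_cancel₀ _ two_ne_zero]
  have hmin : min (A * √τ₀) (b / (2 * τ₀)) ≤ A * √τ + b / (2 * τ) := by
    rcases le_total τ₀ τ with h | h
    · have hsqrt : A * √τ₀ ≤ A * √τ := by gcongr
      exact (min_le_left _ _).trans (hsqrt.trans (le_add_of_nonneg_right (by positivity)))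
    · have hinv : b / (2 * τ₀) ≤ b / (2 * τ) := by gcongr
      exact (min_le_right _ _).trans (hinv.trans (le_add_of_nonneg_left (by positivity)))
  have hexp : Real.exp (-(A * √τ)) * Real.exp (-b / τ) ≤
      Real.exp (-min (A * √τ₀) (b / (2 * τ₀))) * Real.exp (-(b / 2) / τ) := by
    rw [← Real.exp_add, ← Real.exp_add, Real.exp_le_exp]
    have hsplit : -b / τ = -(b / (2 * τ)) + -(b / 2) / τ := by
      field_simp
      ring
    linarith
  calc _ = 2 ^ a * ((b / 2) ^ a / Real.Gamma a * τ ^ (-(a + 1))) *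
        (Real.exp (-(A * √τ)) * Real.exp (-b / τ)) := by rw [invGamma, hpow]; ring
    _ ≤ 2 ^ a * ((b / 2) ^ a / Real.Gamma a * τ ^ (-(a + 1))) *
        (Real.exp (-min (A * √τ₀) (b / (2 * τ₀))) * Real.exp (-(b / 2) / τ)) := by gcongr
    _ = _ := by rw [invGamma]; ring

/-! ### Upper bounds on the marginal density -/

/-- The largest value over `s > 0` of `(2πs) ^ (-n/2) * exp (-R / (2s))`, attained at `s = R / n`:
the maximum likelihood of a model with residual sum of squares `R`. -/
noncomputable def peak (n : ℕ) (R : ℝ) : ℝ :=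
  (2 * Real.pi * (R / n)) ^ (-((n : ℝ) / 2)) * Real.exp (-((n : ℝ) / 2))

section peak

variable {n : ℕ} {R : ℝ}

theorem peak_pos (hn : 0 < n) (hR : 0 < R) : 0 < peak n R := by
  unfold peak
  positivity

theorem peak_eq_exp (hn : 0 < n) (hR : 0 < R) :
    peak n R = Real.exp (-((n : ℝ) / 2) * (Real.log (2 * Real.pi) + Real.log (R / n) + 1)) := by
  rw [peak, Real.rpow_def_of_pos (by positivity), ← Real.exp_add,
    Real.log_mul (by positivity) (by positivity)]
  ring_nf

theorem rpow_mul_exp_eq_exp {s : ℝ} (hs : 0 < s) (n : ℕ) (R : ℝ) :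
    (2 * Real.pi * s) ^ (-((n : ℝ) / 2)) * Real.exp (-R / (2 * s)) =
      Real.exp (-((n : ℝ) / 2) * (Real.log (2 * Real.pi) + Real.log s) - R / (2 * s)) := by
  rw [Real.rpow_def_of_pos (by positivity), ← Real.exp_add,
    Real.log_mul (by positivity) hs.ne']
  ring_nf

theorem rpow_mul_exp_le_peak (hn : 0 < n) (hR : 0 < R) {s : ℝ} (hs : 0 < s) :
    (2 * Real.pi * s) ^ (-((n : ℝ) / 2)) * Real.exp (-R / (2 * s)) ≤ peak n R := by
  have hn' : (0 : ℝ) < n := Nat.cast_pos.2 hn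
  have hlog := Real.log_le_sub_one_of_pos (show 0 < R / n / s by positivity)
  rw [Real.log_div (by positivity) hs.ne'] at hlog
  have hmul := mul_le_mul_of_nonneg_left hlog (half_pos hn').le
  have hcancel : (n : ℝ) / 2 * (R / n / s) = R / (2 * s) := by field_simp
  rw [peak_eq_exp hn hR, rpow_mul_exp_eq_exp hs, Real.exp_le_exp]
  linarith

theorem peak_le_peak_mul_exp (hn : 0 < n) {T : ℝ} (hR : 0 < R) (hT : 0 < T) :
    peak n R ≤ peak n T * Real.exp ((n : ℝ) / 2 * (T / R - 1)) := by
  have hn' : (0 : ℝ) < n := Nat.cast_pos.2 hn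
  have hlog := Real.log_le_sub_one_of_pos (show 0 < T / R by positivity)
  rw [Real.log_div hT.ne' hR.ne'] at hlog
  have hmul := mul_le_mul_of_nonneg_left hlog (half_pos hn').le
  rw [peak_eq_exp hn hR, peak_eq_exp hn hT, ← Real.exp_add, Real.exp_le_exp,
    Real.log_div hR.ne' hn'.ne', Real.log_div hT.ne' hn'.ne']
  linarith

end peak

section UpperBound

variable {n p r : ℕ} {α₁ α₂ : ℝ} {X : Matrix (Fin n) (Fin p) ℝ} {k : Finset (Fin p)}
  {y : Fin n → ℝ}

theorem likelihood_eq (X : Matrix (Fin n) (Fin p) ℝ) (k : Finset (Fin p)) (s : ℝ) (β : k → ℝ)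
    (y : Fin n → ℝ) : likelihood X k s β y =
      (2 * Real.pi * s) ^ (-((n : ℝ) / 2)) * Real.exp (-rss X k y β / (2 * s)) :=
  rfl

theorem marginal_le_of_integrand_le (hr : 0 < r) {a b a' b' c C : ℝ} (ha : 0 < a) (hb : 0 < b)
    (ha' : 0 < a') (hb' : 0 < b') (hc : 0 < c) (hC : 0 ≤ C)
    (h : ∀ τ > 0, ∀ s > 0, ∀ β : k → ℝ, likelihood X k s β y * piMOM r τ s β *
      invGamma (1 / 2) ((n : ℝ) / 2) τ * invGamma α₁ α₂ s ≤
        C * invGamma a b τ * invGamma a' b' s * piMOM r (τ / c) s β) :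
    marginal r α₁ α₂ X k y ≤ ENNReal.ofReal C :=
  calc marginal r α₁ α₂ X k y
      ≤ ∫⁻ τ in Set.Ioi (0 : ℝ), ∫⁻ s in Set.Ioi (0 : ℝ), ∫⁻ β : k → ℝ, ENNReal.ofReal C *
          ENNReal.ofReal (invGamma a b τ) * ENNReal.ofReal (invGamma a' b' s) *
          ENNReal.ofReal (piMOM r (τ / c) s β) := by
        refine setLIntegral_mono' measurableSet_Ioi fun τ hτ =>
          setLIntegral_mono' measurableSet_Ioi fun s hs => lintegral_mono fun β => ?_
        rw [← ENNReal.ofReal_mul hC, ← ENNReal.ofReal_mul' (invGamma_pos ha' hb' hs).le,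
          ← ENNReal.ofReal_mul' (piMOM_nonneg hr (div_pos hτ hc).le (le_of_lt hs) β)]
        exact ENNReal.ofReal_le_ofReal (h τ hτ s hs β)
    _ = ∫⁻ τ in Set.Ioi (0 : ℝ), ∫⁻ s in Set.Ioi (0 : ℝ), ENNReal.ofReal C *
          ENNReal.ofReal (invGamma a b τ) * ENNReal.ofReal (invGamma a' b' s) := by
        refine setLIntegral_congr_fun measurableSet_Ioi fun τ hτ =>
          setLIntegral_congr_fun measurableSet_Ioi fun s hs => ?_
        rw [lintegral_const_mul' _ _ (by finiteness), lintegral_piMOM hr (div_pos hτ hc) hs,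
          mul_one]
    _ = ∫⁻ τ in Set.Ioi (0 : ℝ), ENNReal.ofReal C * ENNReal.ofReal (invGamma a b τ) := by
        refine setLIntegral_congr_fun measurableSet_Ioi fun τ _ => ?_
        rw [lintegral_const_mul' _ _ (by finiteness), lintegral_invGamma ha' hb', mul_one]
    _ = ENNReal.ofReal C := by
        rw [lintegral_const_mul' _ _ (by finiteness), lintegral_invGamma ha hb, mul_one]

theorem rpow_mul_invGamma_eq {a b m s : ℝ} (ha : 0 < a) (hb : 0 < b) (hm : 0 ≤ m) (hs : 0 < s) :
    (2 * Real.pi * s) ^ (-m) * invGamma a b s =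
      (2 * Real.pi) ^ (-m) * (b ^ (-m) * Real.Gamma (a + m) / Real.Gamma a) *
        invGamma (a + m) b s := by
  have hpow : s ^ (-(a + m + 1)) = s ^ (-m) * s ^ (-(a + 1)) := by
    rw [← Real.rpow_add hs]
    ring_nf
  have hb' : b ^ (-m) * b ^ (a + m) = b ^ a := by
    rw [← Real.rpow_add hb]
    ring_nf
  rw [invGamma, invGamma, Real.mul_rpow (by positivity) hs.le, hpow, ← hb']
  field_simp

theorem marginal_ne_top (hn : 0 < n) (hr : 0 < r) (hα₁ : 0 < α₁) (hα₂ : 0 < α₂) :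
    marginal r α₁ α₂ X k y ≠ ⊤ := by
  have hn2 : (0 : ℝ) < (n : ℝ) / 2 := by positivity
  refine ne_top_of_le_ne_top ENNReal.ofReal_ne_top (marginal_le_of_integrand_le hr one_half_pos hn2
    (add_pos hα₁ hn2) hα₂ one_pos (C := (2 * Real.pi) ^ (-((n : ℝ) / 2)) *
      (α₂ ^ (-((n : ℝ) / 2)) * Real.Gamma (α₁ + n / 2) / Real.Gamma α₁)) (by positivity)
    fun τ hτ s hs β => ?_)
  have hlik : likelihood X k s β y ≤ (2 * Real.pi * s) ^ (-((n : ℝ) / 2)) := by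
    refine mul_le_of_le_one_right (by positivity) (Real.exp_le_one_iff.2 ?_)
    rw [neg_div, neg_nonpos]
    positivity
  have hprior : 0 ≤ piMOM r τ s β * invGamma (1 / 2) (n / 2) τ * invGamma α₁ α₂ s :=
    mul_nonneg (mul_nonneg (piMOM_nonneg hr hτ.le hs.le β)
      (invGamma_pos one_half_pos hn2 hτ).le) (invGamma_pos hα₁ hα₂ hs).le
  calc _ = likelihood X k s β y *
        (piMOM r τ s β * invGamma (1 / 2) (n / 2) τ * invGamma α₁ α₂ s) := by ring
    _ ≤ (2 * Real.pi * s) ^ (-((n : ℝ) / 2)) *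
        (piMOM r τ s β * invGamma (1 / 2) (n / 2) τ * invGamma α₁ α₂ s) := by gcongr
    _ = (2 * Real.pi * s) ^ (-((n : ℝ) / 2)) * invGamma α₁ α₂ s *
        invGamma (1 / 2) (n / 2) τ * piMOM r τ s β := by ring
    _ = _ := by
        rw [rpow_mul_invGamma_eq hα₁ hα₂ hn2.le hs, div_one]
        ring

variable {R h : ℝ} {J : Finset k}

theorem likelihood_le (hn : 0 < n) (hR : 0 < R) {β : k → ℝ}
    (hβ : R + h * ∑ i ∈ J, β i ^ 2 ≤ rss X k y β) {s : ℝ} (hs : 0 < s) :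
    likelihood X k s β y ≤ peak n R * Real.exp (-(h * ∑ i ∈ J, β i ^ 2) / (2 * s)) := by
  have hexp : -rss X k y β / (2 * s) ≤ -R / (2 * s) + -(h * ∑ i ∈ J, β i ^ 2) / (2 * s) := by
    rw [← add_div]
    gcongr
    linarith
  calc likelihood X k s β y ≤ (2 * Real.pi * s) ^ (-((n : ℝ) / 2)) *
        (Real.exp (-R / (2 * s)) * Real.exp (-(h * ∑ i ∈ J, β i ^ 2) / (2 * s))) := by
        rw [likelihood_eq, ← Real.exp_add]
        gcongr
    _ ≤ _ := by
        rw [← mul_assoc]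
        gcongr
        exact rpow_mul_exp_le_peak hn hR hs

theorem marginal_le (hn : 0 < n) (hr : 0 < r) (hα₁ : 0 < α₁) (hα₂ : 0 < α₂) (hR : 0 < R)
    (hh : 0 ≤ h) (hy : ∀ β : k → ℝ, R + h * ∑ i ∈ J, β i ^ 2 ≤ rss X k y β) (τ₀ : ℝ) :
    marginal r α₁ α₂ X k y ≤ ENNReal.ofReal (peak n R * 2 ^ ((r : ℝ) * k.card / 2) *
      2 ^ (1 / 2 : ℝ) * Real.exp (-min (J.card * √h * √τ₀) ((n : ℝ) / (4 * τ₀)))) := by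
  have hn2 : (0 : ℝ) < n / 2 := by positivity
  have hpeak := peak_pos hn hR
  refine marginal_le_of_integrand_le hr one_half_pos (half_pos hn2) hα₁ hα₂ two_pos
    (by positivity) fun τ hτ s hs β => ?_
  have hIGτ := invGamma_pos one_half_pos hn2 hτ
  have hIGs := invGamma_pos hα₁ hα₂ hs
  have hprior := piMOM_nonneg hr hτ.le hs.le β
  have hprior' := piMOM_nonneg hr (half_pos hτ).le hs.le β
  have hlik := likelihood_le hn hR (hy β) hs
  have hβ := exp_mul_piMOM_le hr hh hτ hs J β
  have hτ' := exp_mul_invGamma_le one_half_pos (show 0 ≤ J.card * √h by positivity) hn2 hτ τ₀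
  rw [show (n : ℝ) / 2 / (2 * τ₀) = n / (4 * τ₀) by ring] at hτ'
  rw [Fintype.card_coe, Real.sqrt_mul hh, ← mul_assoc] at hβ
  calc _ ≤ (peak n R * Real.exp (-(h * ∑ i ∈ J, β i ^ 2) / (2 * s))) * piMOM r τ s β *
        invGamma (1 / 2) (n / 2) τ * invGamma α₁ α₂ s := by gcongr
    _ = peak n R * (Real.exp (-(h * ∑ i ∈ J, β i ^ 2) / (2 * s)) * piMOM r τ s β) *
        invGamma (1 / 2) (n / 2) τ * invGamma α₁ α₂ s := by ring
    _ ≤ peak n R * (2 ^ ((r : ℝ) * k.card / 2) * Real.exp (-(J.card * √h * √τ)) *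
        piMOM r (τ / 2) s β) * invGamma (1 / 2) (n / 2) τ * invGamma α₁ α₂ s := by gcongr
    _ = peak n R * 2 ^ ((r : ℝ) * k.card / 2) * piMOM r (τ / 2) s β * invGamma α₁ α₂ s *
        (Real.exp (-(J.card * √h * √τ)) * invGamma (1 / 2) (n / 2) τ) := by ring
    _ ≤ peak n R * 2 ^ ((r : ℝ) * k.card / 2) * piMOM r (τ / 2) s β * invGamma α₁ α₂ s *
        (2 ^ (1 / 2 : ℝ) * Real.exp (-min (J.card * √h * √τ₀) (n / (4 * τ₀))) *
          invGamma (1 / 2) (n / 2 / 2) τ) := by gcongr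
    _ = _ := by ring

theorem two_rpow_mul_two_rpow_half_le_exp {a r z : ℝ} (ha : 0 ≤ a) (hr : r ≤ z) (hz : 1 ≤ z) :
    (2 : ℝ) ^ (r * a / 2) * 2 ^ (1 / 2 : ℝ) ≤ Real.exp ((a + 1) * z) := by
  have hexp : (2 : ℝ) ≤ Real.exp 1 := by linarith [Real.add_one_le_exp 1]
  have hra : r * a ≤ z * a := by gcongr
  have hza : 0 ≤ z * a := by positivity
  calc (2 : ℝ) ^ (r * a / 2) * 2 ^ (1 / 2 : ℝ) = 2 ^ (r * a / 2 + 1 / 2) :=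
        (Real.rpow_add two_pos _ _).symm
    _ ≤ 2 ^ ((a + 1) * z) := Real.rpow_le_rpow_of_exponent_le one_le_two (by linarith)
    _ ≤ Real.exp 1 ^ ((a + 1) * z) := by gcongr
    _ = Real.exp ((a + 1) * z) := Real.exp_one_rpow _

theorem marginal_le_peak_mul_exp (hn : 0 < n) (hr : 0 < r) (hα₁ : 0 < α₁) (hα₂ : 0 < α₂)
    (hR : 0 < R) (hh : 0 ≤ h) (hy : ∀ β : k → ℝ, R + h * ∑ i ∈ J, β i ^ 2 ≤ rss X k y β)
    (τ₀ : ℝ) {T z : ℝ} (hT : 0 < T) (hz : 1 ≤ z) (hrz : r ≤ z) :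
    marginal r α₁ α₂ X k y ≤ ENNReal.ofReal (peak n T * Real.exp (n / 2 * (T / R - 1) +
      (k.card + 1) * z - min (J.card * √h * √τ₀) (n / (4 * τ₀)))) := by
  have hpeak := peak_pos hn hT
  refine (marginal_le hn hr hα₁ hα₂ hR hh hy τ₀).trans (ENNReal.ofReal_le_ofReal ?_)
  calc _ = peak n R * (2 ^ ((r : ℝ) * k.card / 2) * 2 ^ (1 / 2 : ℝ)) *
        Real.exp (-min (J.card * √h * √τ₀) (n / (4 * τ₀))) := by ring
    _ ≤ peak n T * Real.exp (n / 2 * (T / R - 1)) * Real.exp ((k.card + 1) * z) *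
        Real.exp (-min (J.card * √h * √τ₀) (n / (4 * τ₀))) := by
        gcongr
        · exact peak_le_peak_mul_exp hn hR hT
        · exact two_rpow_mul_two_rpow_half_le_exp k.card.cast_nonneg hrz hz
    _ = _ := by
        rw [sub_eq_add_neg _ (min _ _), Real.exp_add, Real.exp_add]
        ring

end UpperBound

/-! ### Wrong models -/

/-- The event on which the error vector `e` behaves as expected: its squared length is of the order
of `n * v`, and its correlation with each column of the design is at most `√n * z`. -/
structure IsTypical {n p : ℕ} (X : Matrix (Fin n) (Fin p) ℝ) (v z : ℝ) (e : Fin n → ℝ) :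
    Prop where
  abs_sum_column_le : ∀ j, |∑ i, X i j * e i| ≤ √n * z
  le_sum_sq : v / 2 * n ≤ ∑ i, e i ^ 2
  sum_sq_le : ∑ i, e i ^ 2 ≤ 2 * v * n

theorem IsTypical.sum_sq_pos {n p : ℕ} {X : Matrix (Fin n) (Fin p) ℝ} {v z : ℝ} {e : Fin n → ℝ}
    (h : IsTypical X v z e) (hn : 0 < n) (hv : 0 < v) : 0 < ∑ i, e i ^ 2 :=
  lt_of_lt_of_le (by positivity) h.le_sum_sq

section Exponents

variable {n a z T : ℝ}

theorem mul_div_add_sub_one_le (hn : 0 < n) (hT : 0 < T) (hz : 1 ≤ z) (hTz : T + n ≤ n * z) :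
    n / 2 * (T / (T + n / z ^ 2) - 1) ≤ -(n / (2 * z ^ 3)) := by
  have hRz : T + n / z ^ 2 ≤ n * z :=
    (add_le_add_right (div_le_self hn.le (one_le_pow₀ hz)) T).trans hTz
  calc n / 2 * (T / (T + n / z ^ 2) - 1) = -(n / 2 * (n / z ^ 2 / (T + n / z ^ 2))) := by
        field_simp
        ring
    _ ≤ -(n / 2 * (n / z ^ 2 / (n * z))) := by gcongr
    _ = -(n / (2 * z ^ 3)) := by field_simp

theorem two_mul_add_sqrt_mul_le_div (ha : 0 ≤ a) (hn : 0 ≤ n) (hz : 8 ≤ z) (hzn : z ^ 20 ≤ √n)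
    (haz : a * z ^ 15 ≤ n) : 2 * (a * z) + √n * z ^ 2 ≤ n / (2 * z ^ 3) := by
  have hz1 : 1 ≤ z := by linarith
  have hmodel : 8 * (a * z ^ 4) ≤ n :=
    calc 8 * (a * z ^ 4) ≤ z ^ 11 * (a * z ^ 4) := by
          gcongr
          exact hz.trans (le_self_pow₀ hz1 (by norm_num))
      _ = a * z ^ 15 := by ring
      _ ≤ n := haz
  have hsqrt : 4 * (√n * z ^ 5) ≤ n :=
    calc 4 * (√n * z ^ 5) ≤ z * (√n * z ^ 5) := by gcongr; linarith
      _ = √n * z ^ 6 := by ring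
      _ ≤ √n * z ^ 20 := by gcongr; norm_num
      _ ≤ √n * √n := by gcongr
      _ = n := Real.mul_self_sqrt hn
  rw [le_div_iff₀ (by positivity)]
  linarith

theorem mul_div_sub_sub_one_le {v : ℝ} (hn : 0 < n) (ha : 0 ≤ a) (hv : 0 < v) (hz : 0 < z)
    (hvz : 8 ≤ v * z) (hT : v / 2 * n ≤ T) (haz : a * z ^ 4 ≤ n) :
    0 < T - 2 * a * z ^ 3 ∧ n / 2 * (T / (T - 2 * a * z ^ 3) - 1) ≤ a * z ^ 4 := by
  have hD : 8 * (a * z ^ 3) ≤ v * n :=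
    calc 8 * (a * z ^ 3) ≤ v * z * (a * z ^ 3) := by gcongr
      _ = v * (a * z ^ 4) := by ring
      _ ≤ v * n := by gcongr
  have hR : v / 4 * n ≤ T - 2 * a * z ^ 3 := by linarith
  have hR0 : 0 < T - 2 * a * z ^ 3 := lt_of_lt_of_le (by positivity) hR
  refine ⟨hR0, ?_⟩
  calc n / 2 * (T / (T - 2 * a * z ^ 3) - 1) = n * (a * z ^ 3) / (T - 2 * a * z ^ 3) := by
        field_simp
        ring
    _ ≤ n * (a * z ^ 3) / (v / 4 * n) := by gcongr
    _ = 4 / v * (a * z ^ 3) := by field_simp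
    _ ≤ z * (a * z ^ 3) := by
        gcongr
        rw [div_le_iff₀ hv]
        linarith
    _ = a * z ^ 4 := by ring

theorem three_mul_add_sqrt_mul_le_mul_sqrt {c : ℝ} (hn : 0 ≤ n) (hz : 16 ≤ z)
    (hzn : z ^ 20 ≤ √n) (hc : 1 ≤ c) (hac : a ≤ 2 * (c * z)) :
    3 * (a * z ^ 4) + √n * z ^ 2 ≤ c * √(n / (2 * z)) * √(z ^ 8) := by
  have hz1 : 1 ≤ z := by linarith
  have hpow : √(z ^ 8) = z ^ 4 := by
    rw [show z ^ 8 = (z ^ 4) ^ 2 by ring, Real.sqrt_sq (by positivity)]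
  have hsqrt : √n / z ≤ √(n / (2 * z)) := by
    refine Real.le_sqrt_of_sq_le ?_
    rw [div_pow, Real.sq_sqrt hn]
    gcongr
    nlinarith
  have hmodel : 3 * (a * z ^ 4) ≤ c * √n * z ^ 2 :=
    calc 3 * (a * z ^ 4) ≤ 3 * (2 * (c * z) * z ^ 4) := by gcongr
      _ = 6 * (c * z ^ 5) := by ring
      _ ≤ z * (c * z ^ 5) := by gcongr; linarith
      _ = c * z ^ 6 := by ring
      _ ≤ c * √n := by
          gcongr
          exact (pow_le_pow_right₀ hz1 (by norm_num)).trans hzn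
      _ ≤ c * √n * z ^ 2 := le_mul_of_one_le_right (by positivity) (one_le_pow₀ hz1)
  calc 3 * (a * z ^ 4) + √n * z ^ 2 ≤ c * √n * z ^ 2 + c * √n * z ^ 2 := by
        gcongr
        exact le_mul_of_one_le_left (Real.sqrt_nonneg n) hc
    _ = 2 * (c * √n * z ^ 2) := by ring
    _ ≤ z * (c * √n * z ^ 2) := by gcongr; linarith
    _ = c * (√n / z) * z ^ 4 := by field_simp
    _ ≤ c * √(n / (2 * z)) * √(z ^ 8) := by rw [hpow]; gcongr

theorem three_mul_add_sqrt_mul_le_div (ha : 0 ≤ a) (hn : 0 ≤ n) (hz : 16 ≤ z)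
    (hzn : z ^ 20 ≤ √n) (haz : a * z ^ 15 ≤ n) :
    3 * (a * z ^ 4) + √n * z ^ 2 ≤ n / (4 * z ^ 8) := by
  have hz1 : 1 ≤ z := by linarith
  have hmodel : 24 * (a * z ^ 12) ≤ n :=
    calc 24 * (a * z ^ 12) ≤ z ^ 3 * (a * z ^ 12) := by
          gcongr
          linarith [pow_le_pow_left₀ (by norm_num) hz 3]
      _ = a * z ^ 15 := by ring
      _ ≤ n := haz
  have hsqrt : 8 * (√n * z ^ 10) ≤ n :=
    calc 8 * (√n * z ^ 10) ≤ z * (√n * z ^ 10) := by gcongr; linarith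
      _ = √n * z ^ 11 := by ring
      _ ≤ √n * z ^ 20 := by gcongr; norm_num
      _ ≤ √n * √n := by gcongr
      _ = n := Real.mul_self_sqrt hn
  rw [le_div_iff₀ (by positivity)]
  linarith

end Exponents

section WrongModel

variable {n p r : ℕ} {α₁ α₂ v z : ℝ} {β₀ : ℕ →₀ ℝ} {X : Matrix (Fin n) (Fin p) ℝ}
  {k : Finset (Fin p)} {e : Fin n → ℝ}

theorem card_union_mul_pow_le (hz : 1 ≤ z)
    (hk : ((k.card : ℝ) + (trueModel p β₀).card + 1) * z ^ 15 ≤ n) {m : ℕ} (hm : m ≤ 15) :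
    ((k ∪ trueModel p β₀).card : ℝ) * z ^ m ≤ n := by
  have hcard : ((k ∪ trueModel p β₀).card : ℝ) ≤ k.card + (trueModel p β₀).card := by
    exact_mod_cast Finset.card_union_le _ _
  refine le_trans ?_ hk
  gcongr
  linarith

theorem card_add_one_mul_pow_le (hz : 0 ≤ z)
    (hk : ((k.card : ℝ) + (trueModel p β₀).card + 1) * z ^ 15 ≤ n) :
    ((k.card : ℝ) + 1) * z ^ 15 ≤ n := by
  refine le_trans ?_ hk
  gcongr
  exact le_add_of_nonneg_right (Nat.cast_nonneg _)

theorem add_le_rss_of_not_subset (hn : 0 < n) (hz : 1 ≤ z) (hX : EigenvalueBounds X z⁻¹)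
    (hβ₀ : ∀ i ∈ β₀.support, 6 ≤ z * β₀ i ^ 2) (he : ∀ j, |∑ i, X i j * e i| ≤ √n * z)
    (hk : ((k ∪ trueModel p β₀).card : ℝ) * z ^ 5 ≤ n) (hkt : ¬ trueModel p β₀ ⊆ k) (β : k → ℝ) :
    ∑ i, e i ^ 2 + n / z ^ 2 ≤ rss X k (observation X β₀ e) β := by
  obtain ⟨j, hj, hjk⟩ := Finset.not_subset.1 hkt
  have hcard : (k ∪ trueModel p β₀).card ≤ n := by
    exact_mod_cast (le_mul_of_one_le_right (Nat.cast_nonneg _) (one_le_pow₀ hz)).trans hk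
  have hloss : 2 * (k ∪ trueModel p β₀).card * z ^ 3 ≤ 2 * (n / z ^ 2) := by
    rw [mul_assoc]
    gcongr
    rw [le_div_iff₀ (by positivity), mul_assoc, ← pow_add]
    exact hk
  have hsq : β₀ j ^ 2 ≤ ∑ i, coeffError β₀ k β i ^ 2 := by
    rw [← neg_sq, ← coeffError_of_notMem β hjk]
    exact Finset.single_le_sum (f := fun i => coeffError β₀ k β i ^ 2)
      (fun _ _ => sq_nonneg _) (Finset.mem_univ j)
  have hgain : 3 * (n / z ^ 2) ≤ n / (2 * z) * ∑ i, coeffError β₀ k β i ^ 2 :=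
    calc 3 * ((n : ℝ) / z ^ 2) = n / (2 * z ^ 2) * 6 := by field_simp; norm_num
      _ ≤ n / (2 * z ^ 2) * (z * β₀ j ^ 2) := by
          gcongr
          exact hβ₀ j (Finsupp.mem_support_iff.2 (mem_trueModel.1 hj))
      _ = n / (2 * z) * β₀ j ^ 2 := by field_simp
      _ ≤ _ := by gcongr
  linarith [le_rss_observation hn (by linarith) hX hcard he β]

theorem marginal_le_of_not_subset (hn : 0 < n) (hr : 0 < r) (hα₁ : 0 < α₁) (hα₂ : 0 < α₂)
    (hv : 0 < v) (hX : EigenvalueBounds X z⁻¹) (he : IsTypical X v z e)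
    (hz : 8 ≤ z) (hrz : r ≤ z) (hvz : 2 * v + 1 ≤ z) (hβ₀ : ∀ i ∈ β₀.support, 6 ≤ z * β₀ i ^ 2)
    (hzn : z ^ 20 ≤ √n) (hk : ((k.card : ℝ) + (trueModel p β₀).card + 1) * z ^ 15 ≤ n)
    (hkt : ¬ trueModel p β₀ ⊆ k) :
    marginal r α₁ α₂ X k (observation X β₀ e) ≤ ENNReal.ofReal
      (peak n (∑ i, e i ^ 2) * Real.exp (-(√n * z ^ 2 + (k.card + 1) * z))) := by
  have hn' : (0 : ℝ) < n := Nat.cast_pos.2 hn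
  have hz1 : 1 ≤ z := by linarith
  have hT := he.sum_sq_pos hn hv
  have hpeak := peak_pos hn hT
  have hTz : ∑ i, e i ^ 2 + n ≤ n * z := by nlinarith [he.sum_sq_le]
  refine (marginal_le_peak_mul_exp hn hr hα₁ hα₂ (R := ∑ i, e i ^ 2 + n / z ^ 2) (h := 0)
    (J := ∅) (by positivity) le_rfl (fun β => ?_) 1 hT hz1 hrz).trans
    (ENNReal.ofReal_le_ofReal ?_)
  · rw [zero_mul, add_zero]
    exact add_le_rss_of_not_subset hn hz1 hX hβ₀ he.abs_sum_column_le
      (card_union_mul_pow_le hz1 hk (by norm_num)) hkt β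
  · have hpenalty : 0 ≤ min (((∅ : Finset k).card : ℝ) * √0 * √1) ((n : ℝ) / (4 * 1)) :=
      le_min (by positivity) (by positivity)
    have hgain := mul_div_add_sub_one_le hn' hT hz1 hTz
    have hcost := two_mul_add_sqrt_mul_le_div (a := k.card + 1) (by positivity) hn'.le hz hzn
      (card_add_one_mul_pow_le (by linarith) hk)
    gcongr
    linarith

/-- The coefficients of the model `k` whose true value is zero. -/
def spurious (β₀ : ℕ →₀ ℝ) (k : Finset (Fin p)) : Finset k :=
  {j | (j : Fin p) ∉ trueModel p β₀}

theorem card_le_card_spurious_add (β₀ : ℕ →₀ ℝ) (k : Finset (Fin p)) :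
    k.card ≤ (spurious β₀ k).card + β₀.support.card := by
  have htrue : (Finset.univ.filter fun j : k => ¬ (j : Fin p) ∉ trueModel p β₀).card ≤
      (trueModel p β₀).card :=
    Finset.card_le_card_of_injOn (fun j => (j : Fin p)) (fun j hj => by simpa using hj)
      Subtype.val_injective.injOn
  have hsplit := Finset.card_filter_add_card_filter_not (s := (Finset.univ : Finset k))
    (fun j => (j : Fin p) ∉ trueModel p β₀)
  rw [Finset.card_univ, Fintype.card_coe] at hsplit
  have hsupport := card_trueModel_le p β₀
  simp only [spurious]
  omega

theorem card_spurious_pos (hkt : trueModel p β₀ ⊂ k) : 0 < (spurious β₀ k).card := by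
  obtain ⟨j, hj, hjt⟩ := Finset.exists_of_ssubset hkt
  exact Finset.card_pos.2 ⟨⟨j, hj⟩, by simpa [spurious] using hjt⟩

theorem sum_sq_spurious_le (β : k → ℝ) :
    ∑ j ∈ spurious β₀ k, β j ^ 2 ≤ ∑ j, coeffError β₀ k β j ^ 2 := by
  have heq : ∀ j ∈ spurious β₀ k, β j ^ 2 = coeffError β₀ k β j ^ 2 := fun j hj => by
    have hjt : β₀ (j : Fin p) = 0 := by simpa [spurious, mem_trueModel] using hj
    rw [coeffError_of_mem β j.2, hjt, sub_zero]
  rw [Finset.sum_congr rfl heq]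
  refine (Finset.sum_map (spurious β₀ k) (Function.Embedding.subtype _)
    (fun j => coeffError β₀ k β j ^ 2)).symm.le.trans ?_
  exact Finset.sum_le_sum_of_subset_of_nonneg (Finset.subset_univ _) fun _ _ _ => sq_nonneg _

theorem marginal_le_of_ssubset (hn : 0 < n) (hr : 0 < r) (hα₁ : 0 < α₁) (hα₂ : 0 < α₂)
    (hv : 0 < v) (hX : EigenvalueBounds X z⁻¹) (he : IsTypical X v z e)
    (hz : 16 ≤ z) (hrz : r ≤ z) (hvz : 8 ≤ v * z) (hβ₀ : (β₀.support.card : ℝ) + 1 ≤ z)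
    (hzn : z ^ 20 ≤ √n) (hk : ((k.card : ℝ) + (trueModel p β₀).card + 1) * z ^ 15 ≤ n)
    (hkt : trueModel p β₀ ⊂ k) :
    marginal r α₁ α₂ X k (observation X β₀ e) ≤ ENNReal.ofReal
      (peak n (∑ i, e i ^ 2) * Real.exp (-(√n * z ^ 2 + (k.card + 1) * z))) := by
  have hn' : (0 : ℝ) < n := Nat.cast_pos.2 hn
  have hz1 : 1 ≤ z := by linarith
  have hT := he.sum_sq_pos hn hv
  have hpeak := peak_pos hn hT
  have hunion : k ∪ trueModel p β₀ = k := Finset.union_eq_left.2 hkt.subset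
  have hkz := card_union_mul_pow_le hz1 hk (m := 4) (by norm_num)
  have hcard : (k ∪ trueModel p β₀).card ≤ n := by
    exact_mod_cast (le_mul_of_one_le_right (Nat.cast_nonneg _) (one_le_pow₀ hz1)).trans hkz
  rw [hunion] at hkz hcard
  have hspurious : (1 : ℝ) ≤ (spurious β₀ k).card := by
    exact_mod_cast card_spurious_pos hkt
  have hcount : (k.card : ℝ) + 1 ≤ 2 * ((spurious β₀ k).card * z) := by
    have hsplit : (k.card : ℝ) ≤ (spurious β₀ k).card + β₀.support.card := by
      exact_mod_cast card_le_card_spurious_add β₀ k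
    nlinarith
  obtain ⟨hR, hgain⟩ := mul_div_sub_sub_one_le hn' k.card.cast_nonneg hv (by linarith) hvz
    he.le_sum_sq hkz
  refine (marginal_le_peak_mul_exp hn hr hα₁ hα₂ (J := spurious β₀ k) hR
    (h := n / (2 * z)) (by positivity) (fun β => ?_) (z ^ 8) hT hz1 hrz).trans
    (ENNReal.ofReal_le_ofReal ?_)
  · have hrss := le_rss_observation hn (by linarith) hX (hunion.symm ▸ hcard)
      he.abs_sum_column_le β
    rw [hunion] at hrss
    refine le_trans ?_ hrss
    gcongr
    exact sum_sq_spurious_le β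
  · have hpenalty := le_min
      (three_mul_add_sqrt_mul_le_mul_sqrt hn'.le hz hzn hspurious hcount)
      (three_mul_add_sqrt_mul_le_div (by positivity) hn'.le hz hzn
        (card_add_one_mul_pow_le (by linarith) hk))
    have hpow : ((k.card : ℝ) + 1) * z ≤ (k.card + 1) * z ^ 4 := by
      gcongr
      exact le_self_pow₀ hz1 (by norm_num)
    have hz4 : 0 ≤ z ^ 4 := by positivity
    gcongr
    linarith

end WrongModel

theorem eventually_marginal_le {r : ℕ} {α₁ α₂ v : ℝ} (hr : 0 < r) (hα₁ : 0 < α₁) (hα₂ : 0 < α₂)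
    (hv : 0 < v) (β₀ : ℕ →₀ ℝ) :
    ∀ᶠ z : ℝ in atTop, ∀ ⦃n p : ℕ⦄ ⦃X : Matrix (Fin n) (Fin p) ℝ⦄ ⦃e : Fin n → ℝ⦄
      ⦃k : Finset (Fin p)⦄, 0 < n → EigenvalueBounds X z⁻¹ → IsTypical X v z e → z ^ 20 ≤ √n →
      ((k.card : ℝ) + (trueModel p β₀).card + 1) * z ^ 15 ≤ n → k ≠ trueModel p β₀ →
      marginal r α₁ α₂ X k (observation X β₀ e) ≤ ENNReal.ofReal
        (peak n (∑ i, e i ^ 2) * Real.exp (-(√n * z ^ 2 + (k.card + 1) * z))) := by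
  have hβ₀ : ∀ᶠ z : ℝ in atTop, ∀ i ∈ β₀.support, 6 ≤ z * β₀ i ^ 2 :=
    (eventually_all_finset β₀.support).2 fun i hi =>
      (tendsto_id.atTop_mul_const (sq_pos_of_ne_zero (Finsupp.mem_support_iff.1 hi)))
        |>.eventually_ge_atTop 6
  filter_upwards [hβ₀, eventually_ge_atTop 16, eventually_ge_atTop (r : ℝ),
    eventually_ge_atTop (2 * v + 1), eventually_ge_atTop (8 / v),
    eventually_ge_atTop ((β₀.support.card : ℝ) + 1)]
    with z hβ₀ hz hrz hvz hvz' htz n p X e k hn hX he hzn hk hkt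
  by_cases hsub : trueModel p β₀ ⊆ k
  · exact marginal_le_of_ssubset hn hr hα₁ hα₂ hv hX he hz hrz ((div_le_iff₀' hv).1 hvz') htz hzn
      hk (hsub.ssubset_of_ne hkt.symm)
  · exact marginal_le_of_not_subset hn hr hα₁ hα₂ hv hX he (by linarith) hrz hvz hβ₀ hzn hk hsub

/-! ### The true model -/

theorem mul_measure_le_setLIntegral {α : Type*} [MeasurableSpace α] {μ : Measure α} {A B : Set α}
    (hA : MeasurableSet A) (hAB : A ⊆ B) {c : ℝ≥0∞} {f : α → ℝ≥0∞} (h : ∀ x ∈ A, c ≤ f x) :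
    c * μ A ≤ ∫⁻ x in B, f x ∂μ := by
  rw [← setLIntegral_const]
  exact (setLIntegral_mono' hA h).trans (lintegral_mono_set hAB)

theorem le_marginal {n p r : ℕ} {α₁ α₂ : ℝ} {X : Matrix (Fin n) (Fin p) ℝ} {k : Finset (Fin p)}
    {y : Fin n → ℝ} {a b c d δ C : ℝ} (ha : 0 < a) (hc : 0 < c) (hcd : c ≤ d) (hδ : 0 ≤ δ)
    (hC : 0 ≤ C) (β' : k → ℝ) (h : ∀ τ ∈ Set.Icc a b, ∀ s ∈ Set.Icc c d,
      ∀ β ∈ Metric.closedBall β' δ, C ≤ likelihood X k s β y * piMOM r τ s β *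
        invGamma (1 / 2) ((n : ℝ) / 2) τ * invGamma α₁ α₂ s) :
    ENNReal.ofReal (C * (2 * δ) ^ k.card * (d - c) * (b - a)) ≤ marginal r α₁ α₂ X k y := by
  have hvol : volume (Metric.closedBall β' δ) = ENNReal.ofReal ((2 * δ) ^ k.card) := by
    rw [Real.volume_pi_closedBall β' hδ, Fintype.card_coe]
  rw [ENNReal.ofReal_mul (mul_nonneg (by positivity) (sub_nonneg.2 hcd)),
    ENNReal.ofReal_mul (by positivity), ENNReal.ofReal_mul hC, ← hvol, ← Real.volume_Icc,
    ← Real.volume_Icc]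
  refine mul_measure_le_setLIntegral measurableSet_Icc (fun τ hτ => ha.trans_le hτ.1)
    fun τ hτ => mul_measure_le_setLIntegral measurableSet_Icc (fun s hs => hc.trans_le hs.1)
    fun s hs => ?_
  rw [← Measure.restrict_univ (μ := (volume : Measure (k → ℝ)))]
  refine (mul_measure_le_setLIntegral Metric.isClosed_closedBall.measurableSet
    (Set.subset_univ _) fun β hβ => ENNReal.ofReal_le_ofReal (h τ hτ s hs β hβ)).trans_eq' ?_
  rw [Measure.restrict_univ]

theorem le_likelihood {n p : ℕ} {X : Matrix (Fin n) (Fin p) ℝ} {k : Finset (Fin p)}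
    {y : Fin n → ℝ} {β : k → ℝ} {T Δ s : ℝ} (hn : 0 < n) (hT : 0 < T) (hΔ : 0 ≤ Δ)
    (hs : s ∈ Set.Icc (T / n) ((1 + 1 / n) * (T / n))) (hrss : rss X k y β ≤ T + Δ) :
    peak n T * Real.exp (-(1 / 2 + Δ / (2 * (T / n)))) ≤ likelihood X k s β y := by
  have hS : 0 < T / n := by positivity
  have hs' : 0 < s := hS.trans_le hs.1
  have hlog : n / 2 * Real.log s ≤ n / 2 * Real.log (T / n) + 1 / 2 :=
    calc n / 2 * Real.log s ≤ n / 2 * Real.log ((1 + 1 / n) * (T / n)) := by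
          gcongr
          exact hs.2
      _ = n / 2 * (Real.log (1 + 1 / n) + Real.log (T / n)) := by
          rw [Real.log_mul (by positivity) hS.ne']
      _ ≤ n / 2 * ((1 + 1 / n - 1) + Real.log (T / n)) := by
          gcongr
          exact Real.log_le_sub_one_of_pos (by positivity)
      _ = n / 2 * Real.log (T / n) + 1 / 2 := by
          field_simp
          ring
  have hquad : rss X k y β / (2 * s) ≤ n / 2 + Δ / (2 * (T / n)) :=
    calc rss X k y β / (2 * s) ≤ (T + Δ) / (2 * (T / n)) := by
          gcongr
          exact hs.1
      _ = n / 2 + Δ / (2 * (T / n)) := by field_simp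
  rw [likelihood_eq, rpow_mul_exp_eq_exp hs', peak_eq_exp hn hT, ← Real.exp_add,
    Real.exp_le_exp]
  linarith

theorem eventually_exp_neg_mul_le {c : ℝ} (hc : 0 < c) (a : ℝ) :
    ∀ᶠ z : ℝ in atTop, ∀ ⦃h : ℝ⦄, 1 ≤ h → Real.exp (-(h * z)) ≤ c * Real.exp (-(a * h)) := by
  filter_upwards [eventually_ge_atTop (|Real.log c| + a)] with z hz h hh
  have hlog : -(|Real.log c| * h) ≤ Real.log c := by
    nlinarith [neg_abs_le (Real.log c), abs_nonneg (Real.log c)]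
  calc Real.exp (-(h * z)) ≤ Real.exp (Real.log c + -(a * h)) := by
        rw [Real.exp_le_exp]
        nlinarith
    _ = c * Real.exp (-(a * h)) := by rw [Real.exp_add, Real.exp_log hc]

theorem eventually_exp_neg_mul_le_piMOMDensity {r : ℕ} (hr : 0 < r) {v b₀ : ℝ} (hv : 0 < v)
    (hb₀ : b₀ ≠ 0) :
    ∀ᶠ z : ℝ in atTop, ∀ ⦃h c b : ℝ⦄, z ≤ h → v / 2 ≤ c → c ≤ 8 * v * h → |b - b₀| ≤ 1 / h →
      Real.exp (-(h * z)) ≤ piMOMDensity r c b := by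
  have hb₀' : 0 < |b₀| := abs_pos.2 hb₀
  filter_upwards [eventually_exp_neg_mul_le (c := (v / 2) ^ ((r : ℝ) / 2) /
    Real.Gamma ((r : ℝ) / 2) * ((|b₀| + 1) ^ (r + 1))⁻¹) (by positivity) (8 * v / (|b₀| / 2) ^ 2),
    eventually_ge_atTop 1, eventually_ge_atTop (2 / |b₀|)] with z hexp hz hzb h c b hzh hvc hch hb
  have hh : 1 ≤ h := hz.trans hzh
  have hinv : 1 / h ≤ |b₀| / 2 := by
    rw [div_le_div_iff₀ (by linarith) two_pos, one_mul, ← div_le_iff₀' hb₀']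
    exact hzb.trans hzh
  have hlower : |b₀| / 2 ≤ |b| := by
    have := abs_sub_abs_le_abs_sub b₀ b
    rw [abs_sub_comm] at this
    linarith
  have hupper : |b| ≤ |b₀| + 1 := by
    have := abs_sub_abs_le_abs_sub b b₀
    have := (div_le_one (by linarith)).2 hh
    linarith
  have hc : 0 < c := (half_pos hv).trans_le hvc
  have hb' : 0 < |b| := (half_pos hb₀').trans_le hlower
  have hbexp : Real.exp (-(8 * v / (|b₀| / 2) ^ 2 * h)) ≤ Real.exp (-c / b ^ 2) := by
    rw [Real.exp_le_exp, neg_div, neg_le_neg_iff, ← sq_abs b, div_mul_eq_mul_div]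
    gcongr
  calc Real.exp (-(h * z)) ≤ (v / 2) ^ ((r : ℝ) / 2) / Real.Gamma ((r : ℝ) / 2) *
        ((|b₀| + 1) ^ (r + 1))⁻¹ * Real.exp (-(8 * v / (|b₀| / 2) ^ 2 * h)) := hexp hh
    _ ≤ piMOMDensity r c b := by
        unfold piMOMDensity
        gcongr

theorem eventually_exp_neg_mul_le_piMOM {r : ℕ} (hr : 0 < r) {v : ℝ} (hv : 0 < v)
    (β₀ : ℕ →₀ ℝ) :
    ∀ᶠ z : ℝ in atTop, ∀ ⦃p : ℕ⦄ ⦃h τ s : ℝ⦄ ⦃β : trueModel p β₀ → ℝ⦄, 0 ≤ z → z ≤ h →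
      v / 2 ≤ τ * s → τ * s ≤ 8 * v * h → (∀ j, |β j - β₀ (j : Fin p)| ≤ 1 / h) →
      Real.exp (-(β₀.support.card * (h * z))) ≤ piMOM r τ s β := by
  have hdensity := (eventually_all_finset β₀.support).2 fun i hi =>
    eventually_exp_neg_mul_le_piMOMDensity hr hv (Finsupp.mem_support_iff.1 hi)
  filter_upwards [hdensity] with z hdensity p h τ s β hz hzh hvc hch hβ
  have hh : 0 ≤ h := hz.trans hzh
  calc Real.exp (-(β₀.support.card * (h * z)))
      ≤ Real.exp (-((trueModel p β₀).card * (h * z))) := by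
        gcongr
        exact card_trueModel_le p β₀
    _ = ∏ _j : trueModel p β₀, Real.exp (-(h * z)) := by
        rw [Finset.prod_const, Finset.card_univ, Fintype.card_coe, ← Real.exp_nat_mul, mul_neg]
    _ ≤ ∏ j, piMOMDensity r (τ * s) (β j) :=
        Finset.prod_le_prod (fun _ _ => Real.exp_nonneg _) fun j _ => hdensity _
          (Finsupp.mem_support_iff.2 (mem_trueModel.1 j.2)) hzh hvc hch (hβ j)
    _ = piMOM r τ s β := (piMOM_eq_prod _ _ _ _).symm

theorem eventually_exp_neg_mul_le_invGamma_half :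
    ∀ᶠ z : ℝ in atTop, ∀ ⦃n : ℕ⦄ ⦃τ : ℝ⦄, 0 < n → τ ∈ Set.Icc (√n) (2 * √n) →
      Real.exp (-(√n * z)) ≤ invGamma (1 / 2) ((n : ℝ) / 2) τ := by
  filter_upwards [eventually_exp_neg_mul_le
    (c := (1 / 2) ^ (1 / 2 : ℝ) / Real.Gamma (1 / 2)) (by positivity) (7 / 2)] with z hz n τ hn hτ
  have hn1 : (1 : ℝ) ≤ n := Nat.one_le_cast.2 hn
  have hsqrt : 0 < √(n : ℝ) := by positivity
  have hpow : Real.exp (-(3 * √n)) ≤ (2 * √n) ^ (-((1 / 2 : ℝ) + 1)) := by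
    rw [Real.rpow_def_of_pos (by positivity), Real.exp_le_exp]
    linarith [Real.log_le_sub_one_of_pos (show 0 < 2 * √(n : ℝ) by positivity)]
  have hquot : (n : ℝ) / 2 / √n = √n / 2 := by
    rw [div_right_comm, Real.div_sqrt]
  refine le_trans ?_ (le_invGamma one_half_pos (by positivity) hsqrt hτ)
  rw [hquot]
  calc Real.exp (-(√n * z)) ≤ (1 / 2) ^ (1 / 2 : ℝ) / Real.Gamma (1 / 2) *
        Real.exp (-(7 / 2 * √n)) := hz (Real.one_le_sqrt.2 hn1)
    _ = (1 / 2) ^ (1 / 2 : ℝ) / Real.Gamma (1 / 2) * Real.exp (-(3 * √n)) *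
        Real.exp (-(√n / 2)) := by
        rw [mul_assoc, ← Real.exp_add]
        ring_nf
    _ ≤ _ := by gcongr

theorem eventually_exp_neg_mul_le_invGamma {a b l : ℝ} (ha : 0 < a) (hb : 0 < b) (hl : 0 < l)
    {u : ℝ} (hlu : l ≤ u) : ∀ᶠ z : ℝ in atTop, ∀ ⦃h x : ℝ⦄, 1 ≤ h → x ∈ Set.Icc l u →
      Real.exp (-(h * z)) ≤ invGamma a b x := by
  have hu : 0 < u := hl.trans_le hlu
  filter_upwards [eventually_exp_neg_mul_le (c := b ^ a / Real.Gamma a * u ^ (-(a + 1)) *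
    Real.exp (-(b / l))) (by positivity) 0] with z hz h x hh hx
  simpa using (hz hh).trans_eq (by simp) |>.trans (le_invGamma ha hb hl hx)

theorem eventually_exp_neg_mul_le_prior {r : ℕ} {α₁ α₂ v : ℝ} (hr : 0 < r) (hα₁ : 0 < α₁)
    (hα₂ : 0 < α₂) (hv : 0 < v) (β₀ : ℕ →₀ ℝ) :
    ∀ᶠ z : ℝ in atTop, ∀ ⦃n p : ℕ⦄ ⦃τ s : ℝ⦄ ⦃β : trueModel p β₀ → ℝ⦄, 0 < n → z ≤ √n →
      τ ∈ Set.Icc (√n) (2 * √n) → s ∈ Set.Icc (v / 2) (4 * v) →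
      (∀ j, |β j - β₀ (j : Fin p)| ≤ 1 / √n) →
      Real.exp (-((β₀.support.card + 2) * (√n * z))) ≤
        piMOM r τ s β * invGamma (1 / 2) ((n : ℝ) / 2) τ * invGamma α₁ α₂ s := by
  filter_upwards [eventually_exp_neg_mul_le_piMOM hr hv β₀, eventually_exp_neg_mul_le_invGamma_half,
    eventually_exp_neg_mul_le_invGamma hα₁ hα₂ (half_pos hv) (show v / 2 ≤ 4 * v by linarith),
    eventually_ge_atTop 1] with z hpiMOM hτprior hsprior hz n p τ s β hn hzn hτ hs hβ
  have hsqrt : 1 ≤ √(n : ℝ) := hz.trans hzn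
  have hs0 : 0 < s := (half_pos hv).trans_le hs.1
  have hlower : v / 2 ≤ τ * s :=
    hs.1.trans (le_mul_of_one_le_left hs0.le (hsqrt.trans hτ.1))
  have hupper : τ * s ≤ 8 * v * √n :=
    calc τ * s ≤ 2 * √n * (4 * v) := by
          gcongr
          exacts [hτ.2, hs.2]
      _ = 8 * v * √n := by ring
  have hβprior := hpiMOM (by linarith) hzn hlower hupper hβ
  calc Real.exp (-((β₀.support.card + 2) * (√n * z))) =
        Real.exp (-(β₀.support.card * (√n * z))) * Real.exp (-(√n * z)) *
          Real.exp (-(√n * z)) := by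
        rw [← Real.exp_add, ← Real.exp_add]
        ring_nf
    _ ≤ _ := by
        have := (Real.exp_nonneg _).trans hβprior
        have := (Real.exp_nonneg _).trans (hτprior hn hτ)
        gcongr
        exacts [hτprior hn hτ, hsprior hsqrt hs]

theorem exp_neg_le_one_div {x : ℝ} (hx : 0 < x) : Real.exp (-x) ≤ 1 / x := by
  rw [Real.exp_neg, ← one_div]
  gcongr
  linarith [Real.add_one_le_exp x]

theorem eventually_exp_neg_mul_le_box {v : ℝ} (hv : 0 < v) (d : ℕ) :
    ∀ᶠ z : ℝ in atTop, ∀ ⦃h S : ℝ⦄ ⦃m : ℕ⦄, 1 ≤ h → v / 2 ≤ S → m ≤ d →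
      Real.exp (-((d + 1) * (h * z))) ≤ (2 * (1 / h)) ^ m * (S / h ^ 2) * h := by
  filter_upwards [eventually_exp_neg_mul_le (half_pos hv) 1, eventually_ge_atTop 1]
    with z hexp hz h S m hh hS hm
  have hh0 : 0 < h := by linarith
  have hball : Real.exp (-(d * (h * z))) ≤ (2 * (1 / h)) ^ m :=
    calc Real.exp (-(d * (h * z))) ≤ Real.exp (-(m * h)) := by
          gcongr
          exact le_mul_of_one_le_right hh0.le hz
      _ = Real.exp (-h) ^ m := by rw [← Real.exp_nat_mul, mul_neg]
      _ ≤ (2 * (1 / h)) ^ m := by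
          gcongr
          linarith [exp_neg_le_one_div hh0, one_div_pos.2 hh0]
  have hrect : Real.exp (-(h * z)) ≤ S / h ^ 2 * h :=
    calc Real.exp (-(h * z)) ≤ v / 2 * Real.exp (-(1 * h)) := hexp hh
      _ ≤ S * (1 / h) := by
          rw [one_mul]
          have := (half_pos hv).trans_le hS
          gcongr
          exact exp_neg_le_one_div hh0
      _ = S / h ^ 2 * h := by field_simp
  calc Real.exp (-((d + 1) * (h * z))) =
        Real.exp (-(d * (h * z))) * Real.exp (-(h * z)) := by
        rw [← Real.exp_add]
        ring_nf
    _ ≤ (2 * (1 / h)) ^ m * (S / h ^ 2 * h) := by gcongr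
    _ = _ := by ring

theorem le_likelihood_observation {n p : ℕ} {X : Matrix (Fin n) (Fin p) ℝ} {e : Fin n → ℝ}
    {β₀ : ℕ →₀ ℝ} {v z s : ℝ} {β : trueModel p β₀ → ℝ} (hn : 0 < n) (hz : 0 ≤ z) (hv : 0 < v)
    (hX : EigenvalueBounds X z⁻¹) (he : IsTypical X v z e) (ht : (trueModel p β₀).card ≤ n)
    (hs : s ∈ Set.Icc ((∑ i, e i ^ 2) / n) ((1 + 1 / n) * ((∑ i, e i ^ 2) / n)))
    (hβ : ∀ j, |β j - β₀ (j : Fin p)| ≤ 1 / √n) :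
    peak n (∑ i, e i ^ 2) * Real.exp (-(1 / 2 + 3 * β₀.support.card / v * z)) ≤
      likelihood X (trueModel p β₀) s β (observation X β₀ e) := by
  have hT := he.sum_sq_pos hn hv
  have hpeak := peak_pos hn hT
  have hS : v ≤ 2 * ((∑ i, e i ^ 2) / n) := by
    linarith [(le_div_iff₀ (by positivity)).2 he.le_sum_sq]
  have hrss := rss_observation_le hn hz hX ht subset_rfl he.abs_sum_column_le hβ
  refine le_trans ?_ (le_likelihood hn hT (by positivity) hs hrss)
  gcongr
  calc 3 * (trueModel p β₀).card * z / (2 * ((∑ i, e i ^ 2) / n))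
      ≤ 3 * β₀.support.card * z / v := by
        gcongr
        exact card_trueModel_le p β₀
    _ = 3 * β₀.support.card / v * z := by ring

theorem exp_neg_mul_sq_le_exp_mul {a d h z : ℝ} (ha : 0 ≤ a) (hh : 1 ≤ h) (hz : 1 ≤ z)
    (hadz : 2 * d + 4 + a ≤ z) : Real.exp (-(h * z ^ 2)) ≤
      Real.exp (-(1 / 2 + a * z)) * Real.exp (-((d + 2) * (h * z))) *
        Real.exp (-((d + 1) * (h * z))) := by
  have hexponent : 1 / 2 + a * z + (d + 2) * (h * z) + (d + 1) * (h * z) ≤ h * z ^ 2 :=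
    calc _ ≤ 1 * (h * z) + a * (h * z) + (d + 2) * (h * z) + (d + 1) * (h * z) := by
          gcongr
          · nlinarith
          · exact le_mul_of_one_le_left (by linarith) hh
      _ = (2 * d + 4 + a) * (h * z) := by ring
      _ ≤ z * (h * z) := by gcongr
      _ = h * z ^ 2 := by ring
  rw [← Real.exp_add, ← Real.exp_add, Real.exp_le_exp]
  linarith

theorem eventually_le_marginal_trueModel {r : ℕ} {α₁ α₂ v : ℝ} (hr : 0 < r) (hα₁ : 0 < α₁)
    (hα₂ : 0 < α₂) (hv : 0 < v) (β₀ : ℕ →₀ ℝ) :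
    ∀ᶠ z : ℝ in atTop, ∀ ⦃n p : ℕ⦄ ⦃X : Matrix (Fin n) (Fin p) ℝ⦄ ⦃e : Fin n → ℝ⦄, 0 < n →
      EigenvalueBounds X z⁻¹ → IsTypical X v z e → z ≤ √n → (trueModel p β₀).card ≤ n →
      ENNReal.ofReal (peak n (∑ i, e i ^ 2) * Real.exp (-(√n * z ^ 2))) ≤
        marginal r α₁ α₂ X (trueModel p β₀) (observation X β₀ e) := by
  set d := β₀.support.card
  filter_upwards [eventually_exp_neg_mul_le_prior hr hα₁ hα₂ hv β₀,
    eventually_exp_neg_mul_le_box hv d, eventually_ge_atTop 1,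
    eventually_ge_atTop (2 * (d : ℝ) + 4 + 3 * d / v)]
    with z hprior hbox hz hzd n p X e hn hX he hzn ht
  have hn1 : (1 : ℝ) ≤ n := Nat.one_le_cast.2 hn
  have hsqrt : 1 ≤ √(n : ℝ) := hz.trans hzn
  have hT := he.sum_sq_pos hn hv
  have hpeak := peak_pos hn hT
  have hS : v / 2 ≤ (∑ i, e i ^ 2) / n := (le_div_iff₀ (by linarith)).2 he.le_sum_sq
  have hS' : (∑ i, e i ^ 2) / n ≤ 2 * v := (div_le_iff₀ (by linarith)).2 he.sum_sq_le
  have hlik := fun (s) (hs : s ∈ Set.Icc _ _) (β) =>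
    le_likelihood_observation (s := s) (β := β) hn (by linarith) hv hX he ht hs
  set T := ∑ i, e i ^ 2
  set C := peak n T * Real.exp (-(1 / 2 + 3 * d / v * z)) *
    Real.exp (-((d + 2) * (√n * z))) with hC
  refine le_trans (ENNReal.ofReal_le_ofReal ?_) (le_marginal (a := √n) (b := 2 * √n)
    (c := T / n) (d := (1 + 1 / n) * (T / n)) (δ := 1 / √n) (C := C) (by positivity)
    (by positivity) (le_mul_of_one_le_left (by positivity) (by simp)) (by positivity)
    (by positivity) (fun j => β₀ (j : Fin p)) fun τ hτ s hs β hβ => ?_)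
  · calc peak n T * Real.exp (-(√n * z ^ 2))
        ≤ peak n T * (Real.exp (-(1 / 2 + 3 * d / v * z)) * Real.exp (-((d + 2) * (√n * z))) *
          Real.exp (-((d + 1) * (√n * z)))) := by
          gcongr
          exact exp_neg_mul_sq_le_exp_mul (by positivity) hsqrt hz hzd
      _ = C * Real.exp (-((d + 1) * (√n * z))) := by rw [hC]; ring
      _ ≤ C * ((2 * (1 / √n)) ^ (trueModel p β₀).card * (T / n / √n ^ 2) * √n) := by
          gcongr
          exact hbox hsqrt hS (card_trueModel_le p β₀)
      _ = _ := by
          rw [Real.sq_sqrt n.cast_nonneg]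
          ring
  · have hcoord : ∀ j, |β j - β₀ (j : Fin p)| ≤ 1 / √n :=
      (dist_pi_le_iff (by positivity)).1 (Metric.mem_closedBall.1 hβ)
    have hs' : s ∈ Set.Icc (v / 2) (4 * v) := by
      refine ⟨hS.trans hs.1, hs.2.trans ?_⟩
      have hn2 : 1 + 1 / (n : ℝ) ≤ 2 := by linarith [(div_le_one (by linarith)).2 hn1]
      calc (1 + 1 / n) * (T / n) ≤ 2 * (2 * v) := by gcongr
        _ = 4 * v := by ring
    rw [hC, mul_assoc (likelihood _ _ _ _ _), mul_assoc (likelihood _ _ _ _ _)]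
    exact mul_le_mul (hlik s hs β hcoord) (hprior hn hzn hτ hs' hcoord) (Real.exp_nonneg _)
      ((by positivity : (0 : ℝ) ≤ _).trans (hlik s hs β hcoord))

/-! ### The posterior distribution -/

theorem sum_pow_card_add_one_le {p : ℕ} {ρ : ℝ} (hρ : 0 ≤ ρ) (hpρ : p * ρ ≤ 1) :
    ∑ k : Finset (Fin p), ρ ^ (k.card + 1) ≤ 3 * ρ := by
  have binomial : ∑ k : Finset (Fin p), ρ ^ k.card = (1 + ρ) ^ p := by
    simpa using (Finset.prod_one_add (f := fun _ : Fin p => ρ) Finset.univ).symm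
  have power_le : (1 + ρ) ^ p ≤ 3 := by
    calc (1 + ρ) ^ p ≤ Real.exp ρ ^ p := by
          gcongr
          linarith [Real.add_one_le_exp ρ]
      _ = Real.exp (p * ρ) := by rw [Real.exp_nat_mul]
      _ ≤ Real.exp 1 := by gcongr
      _ ≤ 3 := by linarith [Real.exp_one_lt_d9]
  calc ∑ k : Finset (Fin p), ρ ^ (k.card + 1) = (1 + ρ) ^ p * ρ := by
        simp_rw [pow_succ, ← Finset.sum_mul, binomial]
    _ ≤ 3 * ρ := by gcongr

theorem div_sum_le_one {ι : Type*} [Fintype ι] (f : ι → ℝ≥0∞) (t : ι) : f t / ∑ k, f k ≤ 1 := by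
  refine ENNReal.div_le_of_le_mul ?_
  rw [one_mul]
  exact Finset.single_le_sum (fun _ _ => zero_le) (Finset.mem_univ t)

theorem one_sub_sum_le_toReal_div_sum {ι : Type*} [Fintype ι] {f : ι → ℝ≥0∞} {c : ι → ℝ} {t : ι}
    (h0 : f t ≠ 0) (htop : f t ≠ ∞) (hc : ∀ k, 0 ≤ c k)
    (hf : ∀ k, k ≠ t → f k ≤ ENNReal.ofReal (c k) * f t) :
    1 - ∑ k, c k ≤ (f t / ∑ k, f k).toReal := by
  classical
  have hc_sum : 0 ≤ ∑ k, c k := Finset.sum_nonneg fun k _ => hc k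
  have hterm : ∀ k, f k ≤ (if k = t then f t else 0) + ENNReal.ofReal (c k) * f t := fun k => by
    split_ifs with h
    · rw [h]
      exact le_self_add
    · rw [zero_add]
      exact hf k h
  have hsum : ∑ k, f k ≤ f t * ENNReal.ofReal (1 + ∑ k, c k) := by
    refine (Finset.sum_le_sum fun k _ => hterm k).trans_eq ?_
    rw [Finset.sum_add_distrib, Finset.sum_ite_eq', if_pos (Finset.mem_univ _), ← Finset.sum_mul,
      ← ENNReal.ofReal_sum_of_nonneg fun k _ => hc k, ENNReal.ofReal_add one_pos.le hc_sum,
      ENNReal.ofReal_one, mul_add, mul_one, mul_comm]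
  rw [← ENNReal.ofReal_le_iff_le_toReal
    (ne_top_of_le_ne_top ENNReal.one_ne_top (div_sum_le_one f t))]
  calc ENNReal.ofReal (1 - ∑ k, c k) ≤ ENNReal.ofReal (1 + ∑ k, c k)⁻¹ := by
        refine ENNReal.ofReal_le_ofReal ?_
        rw [← one_div, le_div_iff₀ (by positivity)]
        nlinarith
    _ = f t / (f t * ENNReal.ofReal (1 + ∑ k, c k)) := by
        rw [ENNReal.div_eq_inv_mul, ENNReal.mul_inv (.inl h0) (.inl htop), mul_right_comm,
          ENNReal.inv_mul_cancel h0 htop, one_mul, ENNReal.ofReal_inv_of_pos (by positivity)]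
    _ ≤ f t / ∑ k, f k := by gcongr

theorem posterior_le_one {n p : ℕ} (r : ℕ) (α₁ α₂ : ℝ) (prior : PMF (Finset (Fin p)))
    (X : Matrix (Fin n) (Fin p) ℝ) (k : Finset (Fin p)) (y : Fin n → ℝ) :
    posterior r α₁ α₂ prior X k y ≤ 1 :=
  ENNReal.toReal_le_of_le_ofReal one_pos.le
    ((div_sum_le_one (fun l => prior l * marginal r α₁ α₂ X l y) k).trans_eq
      ENNReal.ofReal_one.symm)

section PriorRatio

variable {α : Type*} {prior : PMF α} {t : α} {w : ℝ}

theorem prior_ne_zero_of_ratio_gt (hw : 0 < w)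
    (h : ∀ k, 0 < prior k → w < (prior t).toReal / (prior k).toReal) : prior t ≠ 0 := by
  obtain ⟨k, hk⟩ := prior.support_nonempty
  intro ht
  have hratio := h k (pos_iff_ne_zero.mpr hk)
  rw [ht, ENNReal.toReal_zero, zero_div] at hratio
  exact hw.not_gt hratio

theorem prior_le_of_ratio_gt (hw : 0 < w) {k : α} (hk : 0 < prior k)
    (h : w < (prior t).toReal / (prior k).toReal) : prior k ≤ ENNReal.ofReal w⁻¹ * prior t := by
  rw [lt_div_iff₀ (ENNReal.toReal_pos hk.ne' (prior.apply_ne_top k))] at h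
  rw [← ENNReal.ofReal_toReal (prior.apply_ne_top k),
    ← ENNReal.ofReal_toReal (prior.apply_ne_top t), ← ENNReal.ofReal_mul (by positivity)]
  refine ENNReal.ofReal_le_ofReal ?_
  rw [inv_mul_eq_div, le_div_iff₀ hw, mul_comm]
  exact h.le

end PriorRatio

theorem one_sub_le_posterior {n p r : ℕ} {α₁ α₂ : ℝ} {prior : PMF (Finset (Fin p))}
    {X : Matrix (Fin n) (Fin p) ℝ} {t : Finset (Fin p)} {y : Fin n → ℝ} {w ρ : ℝ} (hw : 0 < w)
    (hρ : 0 ≤ ρ) (hpρ : p * ρ ≤ 1) (hm0 : marginal r α₁ α₂ X t y ≠ 0)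
    (hm : marginal r α₁ α₂ X t y ≠ ∞)
    (hprior : ∀ k, 0 < prior k → w < (prior t).toReal / (prior k).toReal)
    (hk : ∀ k, k ≠ t → 0 < prior k →
      marginal r α₁ α₂ X k y ≤ ENNReal.ofReal (ρ ^ (k.card + 1)) * marginal r α₁ α₂ X t y) :
    1 - 3 * ρ / w ≤ posterior r α₁ α₂ prior X t y := by
  have hweight : ∀ k, k ≠ t → prior k * marginal r α₁ α₂ X k y ≤
      ENNReal.ofReal (w⁻¹ * ρ ^ (k.card + 1)) * (prior t * marginal r α₁ α₂ X t y) := by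
    intro k hkt
    obtain hk0 | hk0 := eq_zero_or_pos (prior k)
    · simp [hk0]
    calc prior k * marginal r α₁ α₂ X k y
        ≤ (ENNReal.ofReal w⁻¹ * prior t) *
          (ENNReal.ofReal (ρ ^ (k.card + 1)) * marginal r α₁ α₂ X t y) :=
          mul_le_mul' (prior_le_of_ratio_gt hw hk0 (hprior k hk0)) (hk k hkt hk0)
      _ = _ := by
          rw [ENNReal.ofReal_mul (by positivity)]
          ring
  have hpenalty : ∑ k : Finset (Fin p), w⁻¹ * ρ ^ (k.card + 1) ≤ 3 * ρ / w := by
    rw [← Finset.mul_sum, div_eq_inv_mul]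
    gcongr
    exact sum_pow_card_add_one_le hρ hpρ
  calc 1 - 3 * ρ / w ≤ 1 - ∑ k : Finset (Fin p), w⁻¹ * ρ ^ (k.card + 1) := by linarith
    _ ≤ posterior r α₁ α₂ prior X t y :=
      one_sub_sum_le_toReal_div_sum (f := fun k => prior k * marginal r α₁ α₂ X k y)
        (mul_ne_zero (prior_ne_zero_of_ratio_gt hw hprior) hm0)
        (ENNReal.mul_ne_top (prior.apply_ne_top t) hm) (fun _ => by positivity) hweight

theorem eventually_one_sub_le_posterior {r : ℕ} (hr : 0 < r) {α₁ α₂ v w : ℝ} (hα₁ : 0 < α₁)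
    (hα₂ : 0 < α₂) (hv : 0 < v) (hw : 0 < w) (β₀ : ℕ →₀ ℝ) :
    ∀ᶠ z in atTop, ∀ ⦃n p : ℕ⦄ ⦃X : Matrix (Fin n) (Fin p) ℝ⦄ ⦃e : Fin n → ℝ⦄
      ⦃prior : PMF (Finset (Fin p))⦄, 0 < n → EigenvalueBounds X z⁻¹ → IsTypical X v z e →
      z ^ 20 ≤ √n → p * Real.exp (-z) ≤ 1 →
      (∀ k, 0 < prior k → ((k.card : ℝ) + (trueModel p β₀).card + 1) * z ^ 15 ≤ n) →
      (∀ k, 0 < prior k → w < (prior (trueModel p β₀)).toReal / (prior k).toReal) →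
      1 - 3 * Real.exp (-z) / w ≤
        posterior r α₁ α₂ prior X (trueModel p β₀) (observation X β₀ e) := by
  filter_upwards [eventually_marginal_le hr hα₁ hα₂ hv β₀,
    eventually_le_marginal_trueModel hr hα₁ hα₂ hv β₀, eventually_ge_atTop 1]
    with z hupper hlower hz n p X e prior hn hX he hzn hpz hcard hratio
  have htrue_card : (trueModel p β₀).card ≤ n := by
    have ht := hcard _ (pos_iff_ne_zero.mpr (prior_ne_zero_of_ratio_gt hw hratio))
    have : ((trueModel p β₀).card : ℝ) ≤ n := by
      refine le_trans ?_ (le_trans (le_mul_of_one_le_right (by positivity) (one_le_pow₀ hz)) ht)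
      linarith [Nat.cast_nonneg (α := ℝ) (trueModel p β₀).card]
    exact_mod_cast this
  have hpeak := peak_pos hn (he.sum_sq_pos hn hv)
  have hlow := hlower hn hX he ((le_self_pow₀ hz (by norm_num)).trans hzn) htrue_card
  refine one_sub_le_posterior hw (Real.exp_nonneg _) hpz
    ((ENNReal.ofReal_pos.mpr (by positivity)).trans_le hlow).ne'
    (marginal_ne_top hn hr hα₁ hα₂) hratio fun k hkt hk => ?_
  refine ((hupper hn hX he hzn (hcard k hk) hkt).trans_eq ?_).trans (mul_le_mul_right hlow _)
  rw [← ENNReal.ofReal_mul (by positivity), neg_add, Real.exp_add, ← Real.exp_nat_mul]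
  congr 1
  push_cast
  ring_nf

/-! ### Concentration of the errors -/

section Concentration

variable {Ω ι : Type*} [MeasurableSpace Ω] {P : Measure Ω}

theorem hasSubgaussianMGF_mono {Y : Ω → ℝ} {c c' : ℝ≥0} (hY : HasSubgaussianMGF Y c P)
    (h : c ≤ c') : HasSubgaussianMGF Y c' P where
  integrable_exp_mul := hY.integrable_exp_mul
  mgf_le t := (hY.mgf_le t).trans (by gcongr)

theorem hasSubgaussianMGF_id_gaussianReal (v : ℝ≥0) :
    HasSubgaussianMGF id v (gaussianReal 0 v) where
  integrable_exp_mul := integrable_exp_mul_gaussianReal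
  mgf_le t := by simp [mgf_id_gaussianReal]

theorem integral_sq_gaussianReal_zero (v : ℝ≥0) : ∫ x, x ^ 2 ∂(gaussianReal 0 v) = v := by
  rw [← variance_id_gaussianReal (μ := 0) (v := v),
    variance_of_integral_eq_zero aemeasurable_id integral_id_gaussianReal]
  rfl

theorem memLp_two_sq_of_hasSubgaussianMGF {Y : Ω → ℝ} {c : ℝ≥0} (hY : HasSubgaussianMGF Y c P) :
    MemLp (fun ω => Y ω ^ 2) 2 P := by
  rw [memLp_two_iff_integrable_sq (hY.aemeasurable.pow_const 2).aestronglyMeasurable]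
  simp_rw [← pow_mul]
  exact integrable_pow_of_integrable_exp_mul one_ne_zero (hY.integrable_exp_mul 1)
    (hY.integrable_exp_mul (-1)) (2 * 2)

theorem pos_of_hasSubgaussianMGF {μ : Measure ℝ} {c : ℝ≥0} (hμ : HasSubgaussianMGF id c μ)
    (hv : 0 < ∫ x, x ^ 2 ∂μ) : 0 < c := by
  refine pos_iff_ne_zero.mpr fun hc => hv.ne' ?_
  rw [hc] at hμ
  refine integral_eq_zero_of_ae ?_
  filter_upwards [hμ.ae_eq_zero_of_hasSubgaussianMGF_zero] with x hx
  simp [show x = 0 from hx]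

theorem measure_lt_abs_le_of_hasSubgaussianMGF [IsFiniteMeasure P] {Y : Ω → ℝ} {c : ℝ≥0}
    (hY : HasSubgaussianMGF Y c P) {M : ℝ} (hM : 0 ≤ M) :
    P {ω | M < |Y ω|} ≤ ENNReal.ofReal (2 * Real.exp (-M ^ 2 / (2 * c))) := by
  rw [← ofReal_measureReal]
  refine ENNReal.ofReal_le_ofReal ?_
  calc P.real {ω | M < |Y ω|} ≤ P.real ({ω | M ≤ Y ω} ∪ {ω | M ≤ (-Y) ω}) :=
        measureReal_mono fun ω (hω : M < |Y ω|) =>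
          (lt_abs.mp hω).imp (fun h => h.le) fun h => h.le
    _ ≤ P.real {ω | M ≤ Y ω} + P.real {ω | M ≤ (-Y) ω} := measureReal_union_le _ _
    _ ≤ 2 * Real.exp (-M ^ 2 / (2 * c)) := by
      rw [two_mul]
      exact add_le_add (hY.measure_ge_le hM) (hY.neg.measure_ge_le hM)

variable [Fintype ι]

theorem hasSubgaussianMGF_sum_mul {μ : Measure ℝ} {err : ι → Ω → ℝ} {c b : ℝ≥0}
    (hμ : HasSubgaussianMGF id c μ) (hlaw : ∀ i, HasLaw (err i) μ P) (hindep : iIndepFun err P)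
    {a : ι → ℝ} (ha : ∑ i, a i ^ 2 ≤ b) :
    HasSubgaussianMGF (fun ω => ∑ i, a i * err i ω) (b * c) P := by
  have herr : ∀ i, HasSubgaussianMGF (err i) c P := fun i =>
    (HasSubgaussianMGF.id_map_iff (hlaw i).aemeasurable).mp (by rwa [(hlaw i).map_eq])
  refine hasSubgaussianMGF_mono (HasSubgaussianMGF.sum_of_iIndepFun (s := Finset.univ)
    (hindep.comp (fun i x => a i * x) fun i => measurable_const_mul _)
    fun i _ => (herr i).const_mul (a i)) ?_
  rw [← NNReal.coe_le_coe, NNReal.coe_sum]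
  change ∑ i, a i ^ 2 * (c : ℝ) ≤ b * c
  rw [← Finset.sum_mul]
  gcongr

theorem measure_le_abs_sum_comp_sub_le [IsProbabilityMeasure P] {E : Type*} [MeasurableSpace E]
    {μ : Measure E} {err : ι → Ω → E} {g : E → ℝ} (hlaw : ∀ i, HasLaw (err i) μ P)
    (hindep : iIndepFun err P) (hg : Measurable g) (hgL : MemLp g 2 μ) {c : ℝ} (hc : 0 < c) :
    P {ω | c ≤ |∑ i, g (err i ω) - Fintype.card ι * ∫ x, g x ∂μ|} ≤
      ENNReal.ofReal (Fintype.card ι * Var[g; μ] / c ^ 2) := by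
  have hmemLp : ∀ i, MemLp (g ∘ err i) 2 P := fun i =>
    MemLp.comp_of_map (by rwa [(hlaw i).map_eq]) (hlaw i).aemeasurable
  have hvar : ∀ i, Var[g ∘ err i; P] = Var[g; μ] := fun i => by
    rw [← (hlaw i).map_eq, variance_map hg.aemeasurable (hlaw i).aemeasurable]
  have hmean : ∀ i, ∫ ω, g (err i ω) ∂P = ∫ x, g x ∂μ := fun i =>
    (hlaw i).integral_comp hg.aestronglyMeasurable
  have hvar_sum : Var[∑ i, g ∘ err i; P] = Fintype.card ι * Var[g; μ] := by
    rw [IndepFun.variance_sum (fun i _ => hmemLp i) fun i _ j _ hij =>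
      (hindep.comp (fun _ => g) fun _ => hg).indepFun hij]
    simp [hvar]
  have hmean_sum : ∫ ω, (∑ i, g ∘ err i) ω ∂P = Fintype.card ι * ∫ x, g x ∂μ := by
    simp only [Finset.sum_apply]
    rw [integral_finsetSum _ fun i _ => (hmemLp i).integrable one_le_two]
    simp only [Function.comp_apply, hmean, Finset.sum_const, Finset.card_univ, nsmul_eq_mul]
  have hmemLp_sum : MemLp (∑ i, g ∘ err i) 2 P := memLp_finsetSum' _ fun i _ => hmemLp i
  have hchebyshev := meas_ge_le_variance_div_sq hmemLp_sum hc
  rw [hvar_sum, hmean_sum] at hchebyshev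
  simpa only [Finset.sum_apply, Function.comp_apply] using hchebyshev

theorem measure_not_isTypical_le [IsProbabilityMeasure P] {μ : Measure ℝ} {c : ℝ≥0}
    (hμ : HasSubgaussianMGF id c μ) {v : ℝ} (hμv : ∫ x, x ^ 2 ∂μ = v) (hv : 0 < v) {n p : ℕ}
    (hn : 0 < n) {X : Matrix (Fin n) (Fin p) ℝ} {z : ℝ} (hz : 0 < z)
    (hX : EigenvalueBounds X z⁻¹) {err : Fin n → Ω → ℝ} (hlaw : ∀ i, HasLaw (err i) μ P)
    (hindep : iIndepFun err P) :
    P {ω | ¬ IsTypical X v z fun i => err i ω} ≤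
      ENNReal.ofReal (p * (2 * Real.exp (-(z / (2 * c))))) +
        ENNReal.ofReal (Var[fun x => x ^ 2; μ] / (v / 2) ^ 2 / n) := by
  have hn' : (0 : ℝ) < n := by exact_mod_cast hn
  have hsub : {ω | ¬ IsTypical X v z fun i => err i ω} ⊆
      (⋃ j, {ω | √n * z < |∑ i, X i j * err i ω|}) ∪
        {ω | v / 2 * n ≤ |∑ i, err i ω ^ 2 - Fintype.card (Fin n) * ∫ x, x ^ 2 ∂μ|} := by
    intro ω hω
    by_contra h
    simp only [Set.mem_union, Set.mem_iUnion, Set.mem_ofPred_eq, not_or, not_exists, not_lt,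
      not_le, Fintype.card_fin, hμv] at h
    have hdev := abs_lt.mp h.2
    exact hω ⟨h.1, by linarith, by nlinarith⟩
  have hcolumn : ∀ j, P {ω | √n * z < |∑ i, X i j * err i ω|} ≤
      ENNReal.ofReal (2 * Real.exp (-(z / (2 * c)))) := by
    intro j
    have hsum := hasSubgaussianMGF_sum_mul hμ hlaw hindep (a := fun i => X i j)
      (b := (n * z).toNNReal) (by
        rw [Real.coe_toNNReal _ (by positivity)]
        simpa using hX.sum_sq_column_le hn j)
    refine (measure_lt_abs_le_of_hasSubgaussianMGF hsum (by positivity)).trans_eq ?_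
    congr 3
    rw [neg_div, mul_pow, Real.sq_sqrt hn'.le, NNReal.coe_mul,
      Real.coe_toNNReal _ (by positivity)]
    field_simp
  refine (measure_mono hsub).trans ((measure_union_le _ _).trans (add_le_add ?_ ?_))
  · refine (measure_iUnion_fintype_le _ _).trans ?_
    refine (Finset.sum_le_sum fun j _ => hcolumn j).trans_eq ?_
    rw [Finset.sum_const, Finset.card_univ, Fintype.card_fin, nsmul_eq_mul,
      ENNReal.ofReal_mul (Nat.cast_nonneg p), ENNReal.ofReal_natCast]
  · refine (measure_le_abs_sum_comp_sub_le hlaw hindep (by fun_prop)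
      (memLp_two_sq_of_hasSubgaussianMGF hμ) (by positivity)).trans_eq ?_
    congr 1
    rw [Fintype.card_fin]
    simp only [id]
    field_simp

theorem tendstoInMeasure_of_tendsto_measure_not {E κ : Type*} [PseudoMetricSpace E] {l : Filter κ}
    {f : κ → Ω → E} {g : Ω → E} {good : κ → Ω → Prop} {b : κ → ℝ} (hb : Tendsto b l (𝓝 0))
    (hfb : ∀ᶠ n in l, ∀ ω, good n ω → dist (f n ω) (g ω) ≤ b n)
    (hbad : Tendsto (fun n => P {ω | ¬ good n ω}) l (𝓝 0)) : TendstoInMeasure P f l g := by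
  rw [tendstoInMeasure_iff_dist]
  intro δ hδ
  refine tendsto_of_tendsto_of_tendsto_of_le_of_le' tendsto_const_nhds hbad
    (.of_forall fun _ => zero_le) ?_
  filter_upwards [hfb, hb.eventually_lt_const hδ] with n hn hbn
  exact measure_mono fun ω hω hgood => hω.not_gt ((hn ω hgood).trans_lt hbn)

end Concentration

/-! ### Rates of growth -/

theorem tendsto_natCast_rpow_atTop {η : ℝ} (hη : 0 < η) :
    Tendsto (fun n : ℕ => (n : ℝ) ^ η) atTop atTop :=
  (tendsto_rpow_atTop hη).comp tendsto_natCast_atTop_atTop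

theorem isBigO_natCast_rpow_of_le {a b : ℝ} (hab : a ≤ b) :
    (fun n : ℕ => (n : ℝ) ^ a) =O[atTop] fun n : ℕ => (n : ℝ) ^ b := by
  refine IsBigO.of_bound' ?_
  filter_upwards [eventually_ge_atTop 1] with n hn
  rw [Real.norm_of_nonneg (by positivity), Real.norm_of_nonneg (by positivity)]
  exact Real.rpow_le_rpow_of_exponent_le (by exact_mod_cast hn) hab

theorem isLittleO_natCast_rpow_of_lt {a b : ℝ} (hab : a < b) :
    (fun n : ℕ => (n : ℝ) ^ a) =o[atTop] fun n : ℕ => (n : ℝ) ^ b := by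
  have hone : (fun _ : ℕ => (1 : ℝ)) =o[atTop] fun n : ℕ => (n : ℝ) ^ (b - a) :=
    (isLittleO_one_left_iff ℝ).mpr
      (tendsto_norm_atTop_atTop.comp (tendsto_natCast_rpow_atTop (sub_pos.mpr hab)))
  refine ((isBigO_refl (fun n : ℕ => (n : ℝ) ^ a) atTop).mul_isLittleO hone).congr' ?_ ?_
  · exact .of_forall fun n => mul_one _
  · filter_upwards [eventually_gt_atTop 0] with n hn
    rw [← Real.rpow_add (by exact_mod_cast hn), add_sub_cancel]

theorem eventually_le_of_isLittleO {α : Type*} {l : Filter α} {f g : α → ℝ} (h : f =o[l] g)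
    (hg : ∀ x, 0 ≤ g x) : ∀ᶠ x in l, f x ≤ g x := by
  filter_upwards [h.eventuallyLE] with x hx
  rw [Real.norm_of_nonneg (hg x)] at hx
  exact (le_abs_self _).trans hx

theorem eventually_le_rpow_of_isBigO_log_rpow {u : ℕ → ℝ} {s η : ℝ} (hη : 0 < η)
    (hu : u =O[atTop] fun n : ℕ => (Real.log n) ^ s) :
    ∀ᶠ n : ℕ in atTop, u n ≤ (n : ℝ) ^ η :=
  eventually_le_of_isLittleO (hu.trans_isLittleO
    ((isLittleO_log_rpow_rpow_atTop s hη).comp_tendsto tendsto_natCast_atTop_atTop))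
    fun n => Real.rpow_nonneg n.cast_nonneg η

theorem tendsto_mul_exp_neg_rpow_mul {u : ℕ → ℝ} {γ η c : ℝ} (hη : 0 < η) (hc : 0 < c)
    (hu : u =O[atTop] fun n : ℕ => (n : ℝ) ^ γ) :
    Tendsto (fun n : ℕ => u n * Real.exp (-((n : ℝ) ^ η * c))) atTop (𝓝 0) := by
  have hpow : Tendsto (fun n : ℕ => (n : ℝ) ^ γ * Real.exp (-((n : ℝ) ^ η * c))) atTop (𝓝 0) := by
    refine ((tendsto_rpow_mul_exp_neg_mul_atTop_nhds_zero (γ / η) c hc).comp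
      (tendsto_natCast_rpow_atTop hη)).congr fun n => ?_
    simp only [Function.comp_apply]
    rw [← Real.rpow_mul (Nat.cast_nonneg n), mul_div_cancel₀ _ hη.ne', neg_mul, mul_comm c]
  exact (hu.mul (isBigO_refl _ _)).trans_tendsto hpow

theorem exists_rpow_rate {q : ℕ → ℝ} {ξ : ℝ} (hξ : ξ < 1)
    (hq : q =O[atTop] fun n : ℕ => (n : ℝ) ^ ξ) (a : ℝ) :
    ∃ η : ℝ, 0 < η ∧ (∀ᶠ n : ℕ in atTop, ((n : ℝ) ^ η) ^ 20 ≤ √n) ∧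
      ∀ᶠ n : ℕ in atTop, (q n + a) * ((n : ℝ) ^ η) ^ 15 ≤ n := by
  obtain ⟨ξ', hξ', hξ0, hξ1⟩ : ∃ ξ', ξ ≤ ξ' ∧ 0 ≤ ξ' ∧ ξ' < 1 :=
    ⟨max ξ 0, le_max_left _ _, le_max_right _ _, max_lt hξ one_pos⟩
  obtain ⟨η, hη, hη40, hη16⟩ : ∃ η : ℝ, 0 < η ∧ η ≤ 1 / 40 ∧ η ≤ (1 - ξ') / 16 :=
    ⟨min (1 / 40) ((1 - ξ') / 16), lt_min (by norm_num) (by linarith), min_le_left _ _,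
      min_le_right _ _⟩
  have hpow : ∀ m n : ℕ, ((n : ℝ) ^ η) ^ m = (n : ℝ) ^ (η * m) := fun m n => by
    rw [← Real.rpow_natCast, ← Real.rpow_mul n.cast_nonneg]
  refine ⟨η, hη, ?_, ?_⟩
  · filter_upwards [eventually_ge_atTop 1] with n hn
    rw [hpow, Real.sqrt_eq_rpow]
    refine Real.rpow_le_rpow_of_exponent_le (by exact_mod_cast hn) ?_
    push_cast
    linarith
  · have hconst : (fun _ : ℕ => a) =O[atTop] fun n : ℕ => (n : ℝ) ^ ξ' :=
      (isBigO_const_const a one_ne_zero atTop).trans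
        (by simpa using isBigO_natCast_rpow_of_le hξ0)
    have hlt : ξ' + η * (15 : ℕ) < 1 := by
      push_cast
      linarith
    refine eventually_le_of_isLittleO ((((hq.trans (isBigO_natCast_rpow_of_le hξ')).add
      hconst).mul (isBigO_refl _ _)).trans_isLittleO
      ((isLittleO_natCast_rpow_of_lt hlt).congr' ?_ ?_)) fun n => n.cast_nonneg
    · filter_upwards [eventually_gt_atTop 0] with n hn
      rw [Real.rpow_add (by exact_mod_cast hn), hpow]
    · exact .of_forall fun n => Real.rpow_one _

theorem tendsto_measure_not_isTypical {Ω : Type*} [MeasurableSpace Ω] {P : Measure Ω}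
    [IsProbabilityMeasure P] {μ : Measure ℝ} {c : ℝ≥0} (hμ : HasSubgaussianMGF id c μ)
    (hv : 0 < ∫ x, x ^ 2 ∂μ) {p : ℕ → ℕ} {X : ∀ n, Matrix (Fin n) (Fin (p n)) ℝ}
    {err : ∀ n, Fin n → Ω → ℝ} (hlaw : ∀ n i, HasLaw (err n i) μ P)
    (hindep : ∀ n, iIndepFun (err n) P) {γ η : ℝ} (hη : 0 < η)
    (hp : (fun n => (p n : ℝ)) =O[atTop] fun n : ℕ => (n : ℝ) ^ γ)
    (hX : ∀ᶠ n : ℕ in atTop, EigenvalueBounds (X n) ((n : ℝ) ^ η)⁻¹) :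
    Tendsto (fun n : ℕ =>
      P {ω | ¬ IsTypical (X n) (∫ x, x ^ 2 ∂μ) ((n : ℝ) ^ η) fun i => err n i ω}) atTop (𝓝 0) := by
  have hc : (0 : ℝ) < c := pos_of_hasSubgaussianMGF hμ hv
  have hcolumns : Tendsto (fun n : ℕ => (p n : ℝ) * (2 * Real.exp (-((n : ℝ) ^ η / (2 * c)))))
      atTop (𝓝 0) := by
    simpa [div_eq_mul_inv, mul_left_comm] using
      (tendsto_mul_exp_neg_rpow_mul hη (show 0 < (2 * (c : ℝ))⁻¹ by positivity) hp).const_mul 2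
  have hsquares := tendsto_const_div_atTop_nhds_zero_nat
    (Var[fun x => x ^ 2; μ] / ((∫ x, x ^ 2 ∂μ) / 2) ^ 2)
  have hbound := (ENNReal.tendsto_ofReal hcolumns).add (ENNReal.tendsto_ofReal hsquares)
  rw [ENNReal.ofReal_zero, add_zero] at hbound
  refine tendsto_of_tendsto_of_tendsto_of_le_of_le' tendsto_const_nhds hbound
    (.of_forall fun _ => zero_le) ?_
  filter_upwards [hX, eventually_gt_atTop 0] with n hXn hn
  exact measure_not_isTypical_le hμ rfl hv hn (by positivity) hXn (hlaw n) (hindep n)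

end HyperPiMOM

open HyperPiMOM in
theorem corollary1_general (r : ℕ) (hr : 1 ≤ r) (α₁ α₂ : ℝ) (hα₁ : 0 < α₁) (hα₂ : 0 < α₂)
    (p : ℕ → ℕ) (X : ∀ n, Matrix (Fin n) (Fin (p n)) ℝ) (prior : ∀ n, PMF (Finset (Fin (p n))))
    (β₀ : ℕ →₀ ℝ) (μ : Measure ℝ) (c : ℝ≥0) (hμ : HasSubgaussianMGF id c μ)
    (hv : 0 < ∫ x, x ^ 2 ∂μ)
    {Ω : Type*} [MeasurableSpace Ω] (P : Measure Ω) [IsProbabilityMeasure P]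
    (err : ∀ n, Fin n → Ω → ℝ) (herr_law : ∀ n i, HasLaw (err n i) μ P)
    (herr_indep : ∀ n, iIndepFun (err n) P)
    (ε : ℕ → ℝ) (hε : ∀ n, 1 ≤ n → 0 < ε n)
    (hεX : ∀ n, 1 ≤ n → EigenvalueBounds (X n) (ε n))
    (s : ℝ) (hε_rate : (fun n => (ε n)⁻¹) =O[atTop] fun n : ℕ => (Real.log n) ^ s)
    (γ : ℝ) (hp : (fun n => (p n : ℝ)) =O[atTop] fun n : ℕ => (n : ℝ) ^ γ)
    (q : ℕ → ℝ) (ξ : ℝ) (hξ : ξ < 1) (hq : q =O[atTop] fun n : ℕ => (n : ℝ) ^ ξ)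
    (hprior_q : ∀ n, 1 ≤ n → ∀ k : Finset (Fin (p n)), q n < (k.card : ℝ) → prior n k = 0)
    (w : ℝ) (hw : 0 < w)
    (hprior_w : ∀ n, 1 ≤ n → ∀ k : Finset (Fin (p n)), 0 < prior n k →
      w < (prior n (trueModel (p n) β₀)).toReal / (prior n k).toReal) :
    TendstoInMeasure P
      (fun n ω => posterior r α₁ α₂ (prior n) (X n) (trueModel (p n) β₀)
        (observation (X n) β₀ fun i => err n i ω))
      atTop (fun _ => 1) := by
  obtain ⟨η, hη, hη20, hη15⟩ := exists_rpow_rate hξ hq (β₀.support.card + 1 : ℝ)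
  have hz := tendsto_natCast_rpow_atTop hη
  have hX : ∀ᶠ n : ℕ in atTop, EigenvalueBounds (X n) ((n : ℝ) ^ η)⁻¹ := by
    filter_upwards [eventually_le_rpow_of_isBigO_log_rpow hη hε_rate,
      eventually_ge_atTop 1] with n hle hn
    exact (hεX n hn).mono (by positivity) (inv_le_of_inv_le₀ (hε n hn) hle)
  have hbound : Tendsto (fun n : ℕ => 3 * Real.exp (-(n : ℝ) ^ η) / w) atTop (𝓝 0) := by
    simpa using ((Real.tendsto_exp_neg_atTop_nhds_zero.comp hz).const_mul 3).div_const w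
  have hp_exp := tendsto_mul_exp_neg_rpow_mul hη one_pos hp
  refine tendstoInMeasure_of_tendsto_measure_not hbound ?_
    (tendsto_measure_not_isTypical hμ hv herr_law herr_indep hη hp hX)
  filter_upwards [hz.eventually
      (eventually_one_sub_le_posterior hr hα₁ hα₂ hv hw β₀), hX, hη20, hη15,
    hp_exp.eventually_le_const one_pos, eventually_ge_atTop 1]
    with n hposterior hXn h20 h15 hpn hn ω hω
  have hcard : ∀ k, 0 < prior n k →
      ((k.card : ℝ) + (trueModel (p n) β₀).card + 1) * ((n : ℝ) ^ η) ^ 15 ≤ n := by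
    intro k hk
    have hkq : (k.card : ℝ) ≤ q n := not_lt.mp fun h => hk.ne' (hprior_q n hn k h)
    refine le_trans ?_ h15
    rw [add_assoc]
    gcongr
    exact card_trueModel_le (p n) β₀
  rw [Real.dist_eq, abs_sub_comm,
    abs_of_nonneg (sub_nonneg.mpr (posterior_le_one r α₁ α₂ _ _ _ _))]
  linarith [hposterior hn hXn hω h20 (by simpa using hpn) hcard (hprior_w n hn)]

theorem corollary1
    -- order of the piMOM prior, hyperparameters of the prior on the variance
    (r : ℕ) (hr : 1 ≤ r) (α₁ α₂ : ℝ) (hα₁ : 0 < α₁) (hα₂ : 0 < α₂)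
    -- dimensions, design matrices, priors on the models
    (p : ℕ → ℕ) (X : ∀ n, Matrix (Fin n) (Fin (p n)) ℝ)
    (prior : ∀ n, PMF (Finset (Fin (p n))))
    -- true coefficients and true variance, fixed in n
    (β₀ : ℕ →₀ ℝ) (hβ₀ : ∀ n, 1 ≤ n → β₀.support ⊆ Finset.range (p n))
    (σ₀sq : ℝ≥0) (hσ₀ : 0 < σ₀sq)
    -- i.i.d. Gaussian errors for every n
    {Ω : Type*} [MeasurableSpace Ω] (P : Measure Ω) [IsProbabilityMeasure P]
    (err : ∀ n, Fin n → Ω → ℝ)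
    (herr_law : ∀ n i, HasLaw (err n i) (gaussianReal 0 σ₀sq) P)
    (herr_indep : ∀ n, iIndepFun (err n) P)
    -- eigenvalues of the submatrices of the design
    (ε : ℕ → ℝ) (hε : ∀ n, 1 ≤ n → 0 < ε n ∧ ε n < 1)
    (hεX : ∀ n, 1 ≤ n → HyperPiMOM.EigenvalueBounds (X n) (ε n))
    (hε_rate : (fun n => (ε n)⁻¹) =O[atTop] fun n : ℕ => (Real.log n) ^ ((1 : ℝ) / 8))
    -- growth of the dimension
    (γ : ℝ) (hγ : γ < r)
    (hp : (fun n => (p n : ℝ)) =O[atTop] fun n : ℕ => (n : ℝ) ^ γ)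
    -- no prior mass on large models
    (q : ℕ → ℝ) (ξ : ℝ) (hξ : ξ < 1) (hξγ : ξ < 1 - 4 * γ / (3 * r))
    (hq : q =O[atTop] fun n : ℕ => (n : ℝ) ^ ξ)
    (hprior_q : ∀ n, 1 ≤ n → ∀ k : Finset (Fin (p n)), q n < (k.card : ℝ) → prior n k = 0)
    -- prior ratios bounded below
    (w : ℝ) (hw : 0 < w)
    (hprior_w : ∀ n, 1 ≤ n → ∀ k : Finset (Fin (p n)), 0 < prior n k →
      w < (prior n (HyperPiMOM.trueModel (p n) β₀)).toReal / (prior n k).toReal) :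
    TendstoInMeasure P
      (fun n ω => HyperPiMOM.posterior r α₁ α₂ (prior n) (X n)
        (HyperPiMOM.trueModel (p n) β₀)
        (fun i => (X n *ᵥ fun j : Fin (p n) => β₀ j) i + err n i ω))
      atTop (fun _ => 1) := by
  exact corollary1_general r hr α₁ α₂ hα₁ hα₂ p X prior β₀ _ σ₀sq
    (HyperPiMOM.hasSubgaussianMGF_id_gaussianReal σ₀sq)
    ((HyperPiMOM.integral_sq_gaussianReal_zero σ₀sq).symm ▸ hσ₀) P err herr_law herr_indep ε
    (fun n hn => (hε n hn).1) hεX _ hε_rate γ hp q ξ hξ hq hprior_q w hw hprior_w
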